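/- Let $\mathfrak g$ be a finite-dimensional complex simple Lie algebra with Cartan subalgebra $\mathfrak h$ and simple roots $\alpha_1,\dots,\alpha_r$. Let $(\cdot,\cdot)$ be the form on $\mathfrak h^*$ induced by the Killing form, normalized so that short roots satisfy $(\alpha,\alpha)=2$, and put $d_i=(\alpha_i,\alpha_i)/2$ and $(\alpha_i,\alpha_j)=d_ia_{ij}$. Let $q>0$, $q\neq 1$, be real and $q_i=q^{d_i}$. Let $U_q(\mathfrak g)$ be the quantized enveloping algebra with generators $E_i,F_i,K_i^{\pm1}$, with relations $K_iE_jK_i^{-1}=q_i^{a_{ij}}E_j$, $K_iF_jK_i^{-1}=q_i^{-a_{ij}}F_j$, $[E_i,F_j]=\delta_{ij}\frac{K_i-K_i^{-1}}{q_i-q_i^{-1}}$, commutativity of the $K_i$ and the quantum Serre relations, with coproduct $\Delta(K_i)=K_i\otimes K_i$, $\Delta(E_i)=E_i\otimes K_i+1\otimes E_i$, $\Delta(F_i)=F_i\otimes 1+K_i^{-1}\otimes F_i$, antipode $S(K_i)=K_i^{-1}$, $S(E_i)=-E_iK_i^{-1}$, $S(F_i)=-K_iF_i$, and $*$-structure $K_i^*=K_i$,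 $E_i^*=K_iF_i$, $F_i^*=E_iK_i^{-1}$. For $\lambda=\sum_i n_i\alpha_i$ in the root lattice write $K_\lambda=K_1^{n_1}\cdots K_r^{n_r}$. Let $\mathbb C_q[G]\subset U_q(\mathfrak g)^*$ be the span of the matrix coefficients of the finite-dimensional (type 1) representations of $U_q(\mathfrak g)$, with product $(\phi\psi)(X)=(\phi\otimes\psi)(\Delta(X))$, involution $\phi^*(X)=\overline{\phi(S(X)^*)}$ and actions $(X\triangleright\phi)(Y)=\phi(YX)$, $(\phi\triangleleft X)(Y)=\phi(XY)$. Set $$\mathbb C_q[G/T]=\{a\in\mathbb C_q[G]: K_\lambda\triangleright a=a\ \text{for all}\ \lambda\},\qquad \mathbb C_q[T\backslash G]=\{a\in\mathbb C_q[G]: a\triangleleft K_\lambda=a\ \text{for all}\ \lambda\},$$ where $\lambda$ runs over the root lattice. Let $V(\Lambda)$ be the finite-dimensional irreducible representation with dominant integral highest weight $\Lambda$, with an inner product for which $X^*$ acts as the adjoint of $X$ for all $X \in U_q(\mathfrak g)$. Let $\{v_i\}$ be an orthonormal basis of weight vectors, $v_i$ of weight $\lambda_i$, with dual basis $\{f^i\}$,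 and let $u^i_j(X)=f^i(X\triangleright v_j)$. Define matrices $\mathsf M^n_m,\mathsf N^n_m$ with entries $(\mathsf M^n_m)^i_j=(u^m_i)^*u^n_j$ and $(\mathsf N^n_m)^i_j=u^i_m(u^j_n)^*$, and for complex coefficients $c^m_n$ put $\mathsf P=\sum_{m,n}c^m_n\mathsf M^n_m$ and $\mathsf Q=\sum_{m,n}c^m_n\mathsf N^n_m$. Then: 1) all entries of $\mathsf P$ belong to $\mathbb C_q[T\backslash G]$ if and only if $c^m_n=0$ whenever $\lambda_m\neq\lambda_n$; 2) all entries of $\mathsf Q$ belong to $\mathbb C_q[G/T]$ if and only if $c^m_n=0$ whenever $\lambda_m\neq\lambda_n$. -/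

import Mathlib

open scoped TensorProduct

noncomputable section

namespace QuantumGroup

/-- The symmetric `q`-integer `[n]_p = (p ^ n - p ^ (-n)) / (p - p⁻¹)`. -/
def qInt (p : ℂ) (n : ℕ) : ℂ := (p ^ n - p⁻¹ ^ n) / (p - p⁻¹)

/-- The `q`-factorial `[n]_p! = [1]_p [2]_p ⋯ [n]_p`. -/
def qFact (p : ℂ) (n : ℕ) : ℂ := ∏ k ∈ Finset.range n, qInt p (k + 1)

/-- The `q`-binomial coefficient `[n]_p! / ([r]_p! [n - r]_p!)`, and `0` for `r > n`. -/
def qBinom (p : ℂ) (n r : ℕ) : ℂ :=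
  if r ≤ n then qFact p n / (qFact p r * qFact p (n - r)) else 0

/-- The quantum Serre expression `∑ (-1)^r [N choose r]_p e^(N-r) f e^r`. -/
def serreSum {A : Type*} [Ring A] [Algebra ℂ A] (p : ℂ) (N : ℕ) (e f : A) : A :=
  ∑ r ∈ Finset.range (N + 1), ((-1) ^ r * qBinom p N r) • (e ^ (N - r) * f * e ^ r)

section Serre

/-- The `q`-integers `[n]_p` with `n > 0` do not vanish. -/
def Generic (p : ℂ) : Prop := p ≠ 0 ∧ ∀ n, qInt p (n + 1) ≠ 0

theorem Generic.sub_ne {p : ℂ} (h : Generic p) : p - p⁻¹ ≠ 0 := by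
  intro h0
  exact h.2 0 (by simp [qInt, h0])

theorem qInt_inv (p : ℂ) (n : ℕ) : qInt p⁻¹ n = qInt p n := by
  unfold qInt
  rw [inv_inv, ← neg_sub (p ^ n), ← neg_sub p, neg_div_neg_eq]

theorem qBinom_inv (p : ℂ) (n r : ℕ) : qBinom p⁻¹ n r = qBinom p n r := by
  simp [qBinom, qFact, qInt_inv]

theorem Generic.inv {p : ℂ} (h : Generic p) : Generic p⁻¹ :=
  ⟨inv_ne_zero h.1, fun n => by rw [qInt_inv]; exact h.2 n⟩

theorem Generic.qFact_ne {p : ℂ} (h : Generic p) (n : ℕ) : qFact p n ≠ 0 :=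
  Finset.prod_ne_zero_iff.mpr fun k _ => h.2 k

theorem qBinom_zero {p : ℂ} (h : Generic p) (n : ℕ) : qBinom p n 0 = 1 := by
  rw [qBinom, if_pos (Nat.zero_le n), Nat.sub_zero, show qFact p 0 = 1 by simp [qFact], one_mul,
    div_self (h.qFact_ne n)]

theorem qBinom_self {p : ℂ} (h : Generic p) (n : ℕ) : qBinom p n n = 1 := by
  rw [qBinom, if_pos le_rfl, Nat.sub_self, show qFact p 0 = 1 by simp [qFact], mul_one,
    div_self (h.qFact_ne n)]

theorem qBinom_symm (p : ℂ) {n r : ℕ} (hr : r ≤ n) : qBinom p n (n - r) = qBinom p n r := by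
  simp [qBinom, hr, Nat.sub_sub_self hr, mul_comm]

theorem qFact_succ (p : ℂ) (n : ℕ) : qFact p (n + 1) = qFact p n * qInt p (n + 1) := by
  simp [qFact, Finset.prod_range_succ]

theorem qInt_add {p : ℂ} (h : Generic p) (m n : ℕ) :
    qInt p (m + n) = p ^ m * qInt p n + p⁻¹ ^ n * qInt p m := by
  have h1 := h.sub_ne
  have h0 := h.1
  unfold qInt
  rw [← mul_div_assoc, ← mul_div_assoc, ← add_div]
  congr 1
  have e1 : p ^ m * p⁻¹ ^ m = 1 := by rw [← mul_pow, mul_inv_cancel₀ h0, one_pow]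
  have e2 : p ^ n * p⁻¹ ^ n = 1 := by rw [← mul_pow, mul_inv_cancel₀ h0, one_pow]
  ring

theorem qBinom_pascal {p : ℂ} (h : Generic p) {n r : ℕ} (hr : r ≤ n) :
    qBinom p (n + 1) (r + 1) =
      p ^ (r + 1) * qBinom p n (r + 1) + p⁻¹ ^ (n - r) * qBinom p n r := by
  obtain ⟨k, rfl⟩ := Nat.exists_eq_add_of_le hr
  cases k with
  | zero => 
    simp only [add_zero, qBinom_self h]
    simp [qBinom]
  | succ k =>
    have e1 : r + (k + 1) + 1 - (r + 1) = k + 1 := by omega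
    have e2 : r + (k + 1) - (r + 1) = k := by omega
    have e3 : r + (k + 1) - r = k + 1 := by omega
    have l1 : r + 1 ≤ r + (k + 1) + 1 := by omega
    have l2 : r + 1 ≤ r + (k + 1) := by omega
    have l3 : r ≤ r + (k + 1) := by omega
    simp only [qBinom, if_pos l1, if_pos l2, if_pos l3, e1, e2, e3]
    have a1 := h.qFact_ne r
    have a2 := h.qFact_ne k
    have a3 := h.2 r
    have a4 := h.2 k
    rw [qFact_succ p (r + (k + 1)), qFact_succ p r, qFact_succ p k,
      show r + (k + 1) + 1 = (r + 1) + (k + 1) by omega, qInt_add h (r + 1) (k + 1)]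
    field_simp

variable {A : Type*} [Ring A] [Algebra ℂ A]

/-- Serre expressions with an additional parameter `s`. -/
def serreAux (p s : ℂ) (N : ℕ) (e f : A) : A :=
  ∑ r ∈ Finset.range (N + 1), ((-1) ^ r * qBinom p N r * s ^ r) • (e ^ (N - r) * f * e ^ r)

theorem serreSum_eq_aux (p : ℂ) (N : ℕ) (e f : A) : serreSum p N e f = serreAux p 1 N e f := by
  simp [serreSum, serreAux]

theorem serreAux_inv (p s : ℂ) (N : ℕ) (e f : A) :
    serreAux p⁻¹ s N e f = serreAux p s N e f := by
  simp [serreAux, qBinom_inv]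

theorem serreAux_zero {p : ℂ} (h : Generic p) (s : ℂ) (e f : A) : serreAux p s 0 e f = f := by
  simp [serreAux, qBinom_zero h]

theorem serreAux_succ {p : ℂ} (h : Generic p) (s : ℂ) (N : ℕ) (e f : A) :
    serreAux p s (N + 1) e f = e * serreAux p (s * p) N e f
      - (s * p⁻¹ ^ N) • (serreAux p (s * p) N e f * e) := by
  have h0 := h.1
  have t1 : e * serreAux p (s * p) N e f =
      ∑ r ∈ Finset.range (N + 1 + 1),
        ((-1) ^ r * qBinom p N r * (s * p) ^ r) • (e ^ (N + 1 - r) * f * e ^ r) := by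
    rw [Finset.sum_range_succ, show qBinom p N (N + 1) = 0 by simp [qBinom]]
    simp only [mul_zero, zero_mul, zero_smul, add_zero, serreAux, Finset.mul_sum]
    refine Finset.sum_congr rfl fun r hr => ?_
    have : r ≤ N := by simpa [Nat.lt_succ_iff] using hr
    rw [mul_smul_comm, Nat.succ_sub this, pow_succ']
    simp only [mul_assoc]
  have t2 : (s * p⁻¹ ^ N) • (serreAux p (s * p) N e f * e) =
      ∑ r ∈ Finset.range (N + 1),
        ((s * p⁻¹ ^ N) * ((-1) ^ r * qBinom p N r * (s * p) ^ r)) •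
          (e ^ (N - r) * f * e ^ (r + 1)) := by
    simp only [serreAux, Finset.sum_mul, Finset.smul_sum]
    refine Finset.sum_congr rfl fun r hr => ?_
    rw [smul_mul_assoc, smul_smul, pow_succ, mul_assoc (e ^ (N - r) * f)]
  rw [t1, t2, Finset.sum_range_succ', serreAux, Finset.sum_range_succ', add_sub_right_comm,
    ← Finset.sum_sub_distrib]
  congr 1
  · refine Finset.sum_congr rfl fun r hr => ?_
    have hr' : r ≤ N := by simpa [Nat.lt_succ_iff] using hr
    rw [Nat.add_sub_add_right, ← sub_smul, qBinom_pascal h hr']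
    congr 1
    have : p⁻¹ ^ (N - r) = p⁻¹ ^ N * p ^ r := by
      rw [inv_pow, inv_pow]
      field_simp
      rw [← pow_add, Nat.sub_add_cancel hr']
    rw [this]
    ring
  · simp [qBinom_zero h]

/-- If `y x = p⁻² x y` and `y z = t z y` with `t = s p^N`, then `y` drops out of the shifted
Serre expression of length `N + 1`. -/
theorem serreAux_add {p : ℂ} (h : Generic p) {x y z : A} {t : ℂ}
    (hyx : y * x = (p⁻¹ ^ 2) • (x * y)) (hyz : y * z = t • (z * y)) (N : ℕ) :
    ∀ s : ℂ, s * p ^ N = t * p →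
      serreAux p s N (x + y) z = serreAux p s N x z ∧
      y * serreAux p s N x z = (t * p⁻¹ ^ (2 * N)) • (serreAux p s N x z * y) := by
  have h0 := h.1
  induction N with
  | zero => intro s _; simp [serreAux_zero h, hyz]
  | succ N ih =>
    intro s hs
    obtain ⟨i1, i2⟩ := ih (s * p) (by rw [← hs]; ring)
    have hc : s * p⁻¹ ^ N = t * p⁻¹ ^ (2 * N) := by
      have : s = t * p⁻¹ ^ N := by
        rw [pow_succ, ← mul_assoc] at hs
        rw [← mul_right_cancel₀ h0 hs, mul_assoc, ← mul_pow, mul_inv_cancel₀ h0, one_pow, mul_one]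
      rw [this]; ring
    rw [serreAux_succ h, serreAux_succ h, i1, hc]
    set w := serreAux p (s * p) N x z
    refine ⟨?_, ?_⟩
    · rw [add_mul, mul_add, i2, smul_add]; abel
    · rw [mul_sub, mul_smul_comm, ← mul_assoc, hyx, smul_mul_assoc, mul_assoc, i2,
        ← mul_assoc y w x, i2, smul_mul_assoc, mul_assoc w y x, hyx, sub_mul, smul_sub]
      simp only [mul_smul_comm, smul_mul_assoc, smul_smul, mul_assoc]
      congr 2 <;> ring

theorem serreSum_add {p : ℂ} (h : Generic p) {x y z : A} {M : ℕ}
    (hyx : y * x = (p⁻¹ ^ 2) • (x * y)) (hyz : y * z = (p ^ M) • (z * y)) :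
    serreSum p (M + 1) (x + y) z = serreSum p (M + 1) x z := by
  rw [serreSum_eq_aux, serreSum_eq_aux]
  exact (serreAux_add h hyx hyz (M + 1) 1 (by ring)).1

theorem serreSum_inv (p : ℂ) (N : ℕ) (e f : A) : serreSum p⁻¹ N e f = serreSum p N e f := by
  simp [serreSum, qBinom_inv]

theorem serreSum_add_add {p : ℂ} (h : Generic p) {x y x' y' : A} {M : ℕ}
    (hyx : y * x = (p⁻¹ ^ 2) • (x * y)) (hyz : y * x' = (p ^ M) • (x' * y))
    (hxz : x * y' = (p⁻¹ ^ M) • (y' * x)) :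
    serreSum p (M + 1) (x + y) (x' + y') =
      serreSum p (M + 1) x x' + serreSum p (M + 1) y y' := by
  have e : serreSum p (M + 1) (x + y) (x' + y') =
      serreSum p (M + 1) (x + y) x' + serreSum p (M + 1) (x + y) y' := by
    simp only [serreSum, ← Finset.sum_add_distrib, ← smul_add, mul_add, add_mul]
  have hxy : x * y = (p⁻¹⁻¹ ^ 2) • (y * x) := by
    rw [hyx, smul_smul, ← mul_pow, inv_mul_cancel₀ (inv_ne_zero h.1), one_pow, one_smul]
  rw [e, serreSum_add h hyx hyz, add_comm x y, ← serreSum_inv p (M + 1) (y + x),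
    serreSum_add h.inv hxy hxz, serreSum_inv]

/-- Serre expressions in `e k`, `f k'` for elements `k`, `k'` that commute up to scalars with
`e`, `f`. -/
theorem serreAux_twist {p : ℂ} (h : Generic p) {e f k k' : A} {α β : ℂ}
    (hke : k * e = α • (e * k)) (hkf : k * f = β • (f * k)) (hk'e : k' * e = β • (e * k'))
    (hkk : k * k' = k' * k) (N : ℕ) : ∃ γ : ℂ, ∀ s : ℂ,
      serreAux p s N (e * k) (f * k') = γ • (serreAux p s N e f * (k ^ N * k')) ∧
      k * serreAux p s N e f = (α ^ N * β) • (serreAux p s N e f * k) := by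
  induction N with
  | zero => exact ⟨1, fun s => by simp [serreAux_zero h, hkf]⟩
  | succ N ih =>
    obtain ⟨γ, ih⟩ := ih
    have hkN : ∀ n : ℕ, k ^ n * e = (α ^ n) • (e * k ^ n) := by
      intro n
      induction n with
      | zero => simp
      | succ n ihn =>
        rw [pow_succ, mul_assoc, hke, mul_smul_comm, ← mul_assoc, ihn, smul_mul_assoc, smul_smul,
          mul_assoc]
        congr 1; ring
    have hcomm : k ^ N * k' * k = k ^ (N + 1) * k' := by
      rw [mul_assoc, ← hkk, ← mul_assoc, ← pow_succ]
    refine ⟨γ * (α ^ N * β), fun s => ?_⟩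
    obtain ⟨i1, i2⟩ := ih (s * p)
    rw [serreAux_succ h, serreAux_succ h, i1]
    set w := serreAux p (s * p) N e f
    constructor
    · have a1 : e * k * (w * (k ^ N * k')) = (α ^ N * β) • (e * w * (k ^ (N + 1) * k')) := by
        rw [mul_assoc e k, ← mul_assoc k w, i2, smul_mul_assoc, mul_smul_comm]
        simp only [mul_assoc, pow_succ']
      have a2 : w * (k ^ N * k') * (e * k) = (α ^ N * β) • (w * e * (k ^ (N + 1) * k')) := by
        rw [mul_assoc w, mul_assoc (k ^ N), ← mul_assoc k' e, hk'e, smul_mul_assoc, mul_smul_comm,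
          mul_assoc e, ← mul_assoc (k ^ N), hkN, smul_mul_assoc, smul_smul, mul_smul_comm,
          ← hcomm, mul_comm β]
        simp only [mul_assoc]
      rw [mul_smul_comm, a1, smul_mul_assoc, a2, sub_mul, smul_mul_assoc, smul_sub]
      simp only [smul_smul]
      congr 2; ring
    · rw [mul_sub, mul_smul_comm, ← mul_assoc, hke, smul_mul_assoc, mul_assoc, i2,
        ← mul_assoc k w e, i2, smul_mul_assoc, mul_assoc w k e, hke, sub_mul, smul_sub]
      simp only [mul_smul_comm, smul_mul_assoc, smul_smul, mul_assoc]
      congr 2 <;> ring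

theorem serreSum_twist {p : ℂ} (h : Generic p) {e f k k' : A} {α β : ℂ} {N : ℕ}
    (hke : k * e = α • (e * k)) (hkf : k * f = β • (f * k)) (hk'e : k' * e = β • (e * k'))
    (hkk : k * k' = k' * k) (h0 : serreSum p N e f = 0) :
    serreSum p N (e * k) (f * k') = 0 := by
  obtain ⟨γ, hγ⟩ := serreAux_twist h hke hkf hk'e hkk N
  rw [serreSum_eq_aux] at h0 ⊢
  rw [(hγ 1).1, h0, zero_mul, smul_zero]

theorem serreSum_smul (p c c' : ℂ) (N : ℕ) (e f : A) :
    serreSum p N (c • e) (c' • f) = (c ^ N * c') • serreSum p N e f := by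
  simp only [serreSum, Finset.smul_sum]
  refine Finset.sum_congr rfl fun r hr => ?_
  have hr' : r ≤ N := by simpa [Nat.lt_succ_iff] using hr
  simp only [smul_pow, smul_mul_assoc, mul_smul_comm, smul_smul]
  congr 1
  have : c ^ N = c ^ (N - r) * c ^ r := by rw [← pow_add, Nat.sub_add_cancel hr']
  rw [this]; ring

theorem serreSum_op (p : ℂ) (N : ℕ) (e f : A) :
    serreSum p N (MulOpposite.op e) (MulOpposite.op f) =
      ((-1 : ℂ) ^ N) • MulOpposite.op (serreSum p N e f) := by
  unfold serreSum
  rw [← Finset.sum_range_reflect, ← MulOpposite.op_smul, Finset.smul_sum, Finset.op_sum]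
  refine Finset.sum_congr rfl fun r hr => ?_
  have hr' : r ≤ N := by simpa [Nat.lt_succ_iff] using hr
  have e1 : N + 1 - 1 - r = N - r := by omega
  have e2 : N - (N - r) = r := by omega
  rw [e1, e2, qBinom_symm p hr', ← MulOpposite.op_pow, ← MulOpposite.op_pow,
    ← MulOpposite.op_mul, ← MulOpposite.op_mul, ← MulOpposite.op_smul, smul_smul, mul_assoc]
  congr 2
  have : (-1 : ℂ) ^ N = (-1) ^ (N - r) * (-1) ^ r := by rw [← pow_add, Nat.sub_add_cancel hr']
  rw [this]
  have : (-1 : ℂ) ^ r * (-1) ^ r = 1 := by rw [← mul_pow]; simp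
  linear_combination (-(-1 : ℂ) ^ (N - r) * qBinom p N r) * this

theorem map_serreSum {B : Type*} [Ring B] [Algebra ℂ B] (g : A →ₐ[ℂ] B) (p : ℂ) (N : ℕ)
    (e f : A) : g (serreSum p N e f) = serreSum p N (g e) (g f) := by
  simp [serreSum, map_sum]

theorem serreSum_tmul_left {B : Type*} [Ring B] [Algebra ℂ B] (p : ℂ) (N : ℕ) (e f : A)
    {k k' : B} (hk : k * k' = k' * k) :
    serreSum p N (e ⊗ₜ[ℂ] k) (f ⊗ₜ[ℂ] k') = serreSum p N e f ⊗ₜ[ℂ] (k ^ N * k') := by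
  simp only [serreSum, TensorProduct.sum_tmul]
  refine Finset.sum_congr rfl fun r hr => ?_
  have hr' : r ≤ N := by simpa [Nat.lt_succ_iff] using hr
  have : k ^ (N - r) * k' * k ^ r = k ^ N * k' := by
    have c : Commute k k' := hk
    rw [mul_assoc, ← (c.pow_left r).eq, ← mul_assoc, ← pow_add, Nat.sub_add_cancel hr']
  simp only [Algebra.TensorProduct.tmul_pow, Algebra.TensorProduct.tmul_mul_tmul,
    TensorProduct.smul_tmul', this]

theorem serreSum_tmul_right {B : Type*} [Ring B] [Algebra ℂ B] (p : ℂ) (N : ℕ) (e f : A)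
    {k k' : B} (hk : k * k' = k' * k) :
    serreSum p N (k ⊗ₜ[ℂ] e) (k' ⊗ₜ[ℂ] f) = (k ^ N * k') ⊗ₜ[ℂ] serreSum p N e f := by
  simp only [serreSum, TensorProduct.tmul_sum]
  refine Finset.sum_congr rfl fun r hr => ?_
  have hr' : r ≤ N := by simpa [Nat.lt_succ_iff] using hr
  have : k ^ (N - r) * k' * k ^ r = k ^ N * k' := by
    have c : Commute k k' := hk
    rw [mul_assoc, ← (c.pow_left r).eq, ← mul_assoc, ← pow_add, Nat.sub_add_cancel hr']
  simp only [Algebra.TensorProduct.tmul_pow, Algebra.TensorProduct.tmul_mul_tmul,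
    TensorProduct.tmul_smul, this]

end Serre

/-! ### Cartan data and the quantized enveloping algebra -/

/-- A (symmetrized) Cartan matrix `a` with `d i * a i j = d j * a j i`, together with a
deformation parameter `q > 0`, `q ≠ 1`. -/
structure Datum (ι : Type*) where
  a : ι → ι → ℤ
  d : ι → ℝ
  q : ℝ
  a_diag : ∀ i, a i i = 2
  a_nonpos : ∀ i j, i ≠ j → a i j ≤ 0
  d_pos : ∀ i, 0 < d i
  d_symm : ∀ i j, d i * a i j = d j * a j i
  q_pos : 0 < q
  q_ne_one : q ≠ 1

/-- The generators of the quantized enveloping algebra; `Kinv i` stands for `K_i⁻¹`. -/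
inductive Gen (ι : Type*) where
  | E (i : ι) : Gen ι
  | F (i : ι) : Gen ι
  | K (i : ι) : Gen ι
  | Kinv (i : ι) : Gen ι

namespace Datum

variable {ι : Type*} (D : Datum ι)

/-- `q_i = q ^ d_i`, as a complex number. -/
def qi (i : ι) : ℂ := ((D.q ^ D.d i : ℝ) : ℂ)

/-- The relations of the generators in an algebra. -/
structure Realizes {A : Type*} [Ring A] [Algebra ℂ A] (E F K L : ι → A) : Prop where
  K_mul_L : ∀ i, K i * L i = 1
  L_mul_K : ∀ i, L i * K i = 1
  K_comm : ∀ i j, K i * K j = K j * K i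
  K_E_L : ∀ i j, K i * E j * L i = (D.qi i ^ D.a i j) • E j
  K_F_L : ∀ i j, K i * F j * L i = (D.qi i ^ (-D.a i j)) • F j
  E_F_same : ∀ i, E i * F i - F i * E i = (D.qi i - (D.qi i)⁻¹)⁻¹ • (K i - L i)
  E_F_ne : ∀ i j, i ≠ j → E i * F j - F j * E i = 0
  serre_E : ∀ i j, i ≠ j → serreSum (D.qi i) (1 - D.a i j).toNat (E i) (E j) = 0
  serre_F : ∀ i j, i ≠ j → serreSum (D.qi i) (1 - D.a i j).toNat (F i) (F j) = 0

open Gen in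
/-- The defining relations of the quantized enveloping algebra, on the free algebra on the
generators. -/
inductive Rel : FreeAlgebra ℂ (Gen ι) → FreeAlgebra ℂ (Gen ι) → Prop
  | K_mul_L (i) : Rel (.ι ℂ (K i) * .ι ℂ (Kinv i)) 1
  | L_mul_K (i) : Rel (.ι ℂ (Kinv i) * .ι ℂ (K i)) 1
  | K_comm (i j) : Rel (.ι ℂ (K i) * .ι ℂ (K j)) (.ι ℂ (K j) * .ι ℂ (K i))
  | K_E_L (i j) : Rel (.ι ℂ (K i) * .ι ℂ (E j) * .ι ℂ (Kinv i)) ((D.qi i ^ D.a i j) • .ι ℂ (E j))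
  | K_F_L (i j) :
      Rel (.ι ℂ (K i) * .ι ℂ (F j) * .ι ℂ (Kinv i)) ((D.qi i ^ (-D.a i j)) • .ι ℂ (F j))
  | E_F_same (i) : Rel (.ι ℂ (E i) * .ι ℂ (F i) - .ι ℂ (F i) * .ι ℂ (E i))
      ((D.qi i - (D.qi i)⁻¹)⁻¹ • (.ι ℂ (K i) - .ι ℂ (Kinv i)))
  | E_F_ne (i j) (h : i ≠ j) : Rel (.ι ℂ (E i) * .ι ℂ (F j) - .ι ℂ (F j) * .ι ℂ (E i)) 0
  | serre_E (i j) (h : i ≠ j) :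
      Rel (serreSum (D.qi i) (1 - D.a i j).toNat (.ι ℂ (E i)) (.ι ℂ (E j))) 0
  | serre_F (i j) (h : i ≠ j) :
      Rel (serreSum (D.qi i) (1 - D.a i j).toNat (.ι ℂ (F i)) (.ι ℂ (F j))) 0

/-- The quantized universal enveloping algebra `U_q(𝔤)`. -/
def U : Type _ := RingQuot D.Rel

instance : Ring D.U := inferInstanceAs (Ring (RingQuot D.Rel))

instance : Algebra ℂ D.U := inferInstanceAs (Algebra ℂ (RingQuot D.Rel))

/-- The quotient map from the free algebra. -/
def proj : FreeAlgebra ℂ (Gen ι) →ₐ[ℂ] D.U := RingQuot.mkAlgHom ℂ D.Rel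

theorem proj_rel {x y : FreeAlgebra ℂ (Gen ι)} (h : D.Rel x y) : D.proj x = D.proj y :=
  RingQuot.mkAlgHom_rel ℂ h

/-- The image of a generator in `U_q(𝔤)`. -/
def gen (x : Gen ι) : D.U := D.proj (FreeAlgebra.ι ℂ x)

def E (i : ι) : D.U := D.gen (.E i)
def F (i : ι) : D.U := D.gen (.F i)
def K (i : ι) : D.U := D.gen (.K i)
def Kinv (i : ι) : D.U := D.gen (.Kinv i)

theorem realizes_U : D.Realizes D.E D.F D.K D.Kinv := by
  constructor <;> intros <;>
    simp only [E, F, K, Kinv, gen, ← map_mul, ← map_smul, ← map_sub, ← map_serreSum]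
  · rw [← map_one D.proj]; exact D.proj_rel (.K_mul_L _)
  · rw [← map_one D.proj]; exact D.proj_rel (.L_mul_K _)
  · exact D.proj_rel (.K_comm _ _)
  · exact D.proj_rel (.K_E_L _ _)
  · exact D.proj_rel (.K_F_L _ _)
  · exact D.proj_rel (.E_F_same _)
  · rw [← map_zero D.proj]
    exact D.proj_rel (.E_F_ne _ _ (by assumption))
  · rw [← map_zero D.proj]
    exact D.proj_rel (.serre_E _ _ (by assumption))
  · rw [← map_zero D.proj]
    exact D.proj_rel (.serre_F _ _ (by assumption))

section Lift

variable {D} {A : Type*} [Ring A] [Algebra ℂ A] {E F K L : ι → A}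

/-- The values on the generators of the homomorphism given by a realization. -/
def genMap (E F K L : ι → A) : Gen ι → A
  | .E i => E i
  | .F i => F i
  | .K i => K i
  | .Kinv i => L i

/-- The universal property of `U_q(𝔤)`: the algebra homomorphism with prescribed values on
the generators. -/
def lift (h : D.Realizes E F K L) : D.U →ₐ[ℂ] A :=
  RingQuot.liftAlgHom ℂ ⟨FreeAlgebra.lift ℂ (genMap E F K L), by
    intro x y hxy
    cases hxy <;> simp only [map_mul, map_smul, map_sub, map_one, map_zero, map_serreSum,
      FreeAlgebra.lift_ι_apply, genMap]
    · exact h.K_mul_L _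
    · exact h.L_mul_K _
    · exact h.K_comm _ _
    · exact h.K_E_L _ _
    · exact h.K_F_L _ _
    · exact h.E_F_same _
    · exact h.E_F_ne _ _ (by assumption)
    · exact h.serre_E _ _ (by assumption)
    · exact h.serre_F _ _ (by assumption)⟩

theorem lift_gen (h : D.Realizes E F K L) (x : Gen ι) :
    lift h (D.gen x) = genMap E F K L x := by
  have : lift h (D.gen x) = FreeAlgebra.lift ℂ (genMap E F K L) (FreeAlgebra.ι ℂ x) :=
    RingQuot.liftAlgHom_mkAlgHom_apply ..
  rw [this, FreeAlgebra.lift_ι_apply]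

end Lift

section Facts

theorem qi_ne (i : ι) : D.qi i ≠ 0 := by
  simpa [qi] using (Real.rpow_pos_of_pos D.q_pos _).ne'

theorem qInt_ofReal_ne {p : ℝ} (hp : 0 < p) (h1 : p ≠ 1) (n : ℕ) : qInt (p : ℂ) (n + 1) ≠ 0 := by
  have key : ∀ m : ℕ, p ^ (m + 1) - p⁻¹ ^ (m + 1) ≠ 0 := by
    intro m h
    have h2 : p ^ (m + 1) * p ^ (m + 1) = 1 := by
      nth_rewrite 2 [sub_eq_zero.mp h]
      rw [← mul_pow, mul_inv_cancel₀ hp.ne', one_pow]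
    rw [← pow_add] at h2
    exact h1 ((pow_eq_one_iff_of_nonneg hp.le (by omega)).mp h2)
  have e : qInt (p : ℂ) (n + 1) =
      (((p ^ (n + 1) - p⁻¹ ^ (n + 1)) / (p ^ (0 + 1) - p⁻¹ ^ (0 + 1)) : ℝ) : ℂ) := by
    simp [qInt]
  rw [e]
  exact_mod_cast div_ne_zero (key n) (key 0)

theorem generic_qi (i : ι) : Generic (D.qi i) := by
  refine ⟨D.qi_ne i, fun n => qInt_ofReal_ne (Real.rpow_pos_of_pos D.q_pos _) ?_ n⟩
  intro h
  have h' := congrArg Real.log h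
  rw [Real.log_rpow D.q_pos, Real.log_one] at h'
  rcases mul_eq_zero.mp h' with h' | h'
  · exact (D.d_pos i).ne' h'
  · exact D.q_ne_one (Real.eq_one_of_pos_of_log_eq_zero D.q_pos h')

theorem qi_zpow_symm (i j : ι) : D.qi i ^ D.a i j = D.qi j ^ D.a j i := by
  simp only [qi]
  norm_cast
  rw [← Real.rpow_intCast, ← Real.rpow_intCast, ← Real.rpow_mul D.q_pos.le,
    ← Real.rpow_mul D.q_pos.le, D.d_symm]

theorem exists_a {i j : ι} (h : i ≠ j) :
    ∃ M : ℕ, D.a i j = -(M : ℤ) ∧ (1 - D.a i j).toNat = M + 1 := by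
  obtain ⟨M, hM⟩ := Int.eq_ofNat_of_zero_le (neg_nonneg.mpr (D.a_nonpos i j h))
  exact ⟨M, by omega, by omega⟩

variable {D} {A : Type*} [Ring A] [Algebra ℂ A] {E F K L : ι → A}

namespace Realizes

theorem K_E (h : D.Realizes E F K L) (i j : ι) : K i * E j = (D.qi i ^ D.a i j) • (E j * K i) := by
  rw [← smul_mul_assoc, ← h.K_E_L, mul_assoc _ (L i), h.L_mul_K, mul_one]

theorem K_F (h : D.Realizes E F K L) (i j : ι) : K i * F j = (D.qi i ^ (-D.a i j)) • (F j * K i) := by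
  rw [← smul_mul_assoc, ← h.K_F_L, mul_assoc _ (L i), h.L_mul_K, mul_one]

theorem L_E (h : D.Realizes E F K L) (i j : ι) : L i * E j = (D.qi i ^ (-D.a i j)) • (E j * L i) := by
  have e : E j = (D.qi i ^ (-D.a i j)) • (K i * E j * L i) := by
    rw [h.K_E_L, smul_smul, ← zpow_add₀ (D.qi_ne i)]; simp
  conv_lhs => rw [e]
  rw [mul_smul_comm, ← mul_assoc, ← mul_assoc, h.L_mul_K, one_mul]

theorem L_F (h : D.Realizes E F K L) (i j : ι) : L i * F j = (D.qi i ^ D.a i j) • (F j * L i) := by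
  have e : F j = (D.qi i ^ D.a i j) • (K i * F j * L i) := by
    rw [h.K_F_L, smul_smul, ← zpow_add₀ (D.qi_ne i)]; simp
  conv_lhs => rw [e]
  rw [mul_smul_comm, ← mul_assoc, ← mul_assoc, h.L_mul_K, one_mul]

theorem K_L_comm (h : D.Realizes E F K L) (i j : ι) : K i * L j = L j * K i := by
  calc K i * L j = L j * (K j * K i) * L j := by
        rw [← mul_assoc (L j), h.L_mul_K, one_mul]
    _ = L j * K i := by rw [h.K_comm j i, mul_assoc, mul_assoc, h.K_mul_L, mul_one]

theorem L_comm (h : D.Realizes E F K L) (i j : ι) : L i * L j = L j * L i := by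
  calc L i * L j = L i * (L j * K i) * L i := by
        rw [mul_assoc (L i), mul_assoc (L j), h.K_mul_L, mul_one]
    _ = L j * L i := by rw [← h.K_L_comm, ← mul_assoc, h.L_mul_K, one_mul]

end Realizes

end Facts

section Hopf

/-- `Δ(K_i) = K_i ⊗ K_i`, `Δ(E_i) = E_i ⊗ K_i + 1 ⊗ E_i`, `Δ(F_i) = F_i ⊗ 1 + K_i⁻¹ ⊗ F_i`
satisfy the defining relations. -/
theorem realizes_comul : D.Realizes
    (fun i => D.E i ⊗ₜ[ℂ] D.K i + 1 ⊗ₜ[ℂ] D.E i)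
    (fun i => D.F i ⊗ₜ[ℂ] 1 + D.Kinv i ⊗ₜ[ℂ] D.F i)
    (fun i => D.K i ⊗ₜ[ℂ] D.K i) (fun i => D.Kinv i ⊗ₜ[ℂ] D.Kinv i) := by
  have h := D.realizes_U
  have hE : ∀ i j, (1 ⊗ₜ[ℂ] D.E i : D.U ⊗[ℂ] D.U) * (D.E j ⊗ₜ[ℂ] D.K j) =
      (D.qi i ^ (-D.a i j)) • ((D.E j ⊗ₜ[ℂ] D.K j) * (1 ⊗ₜ[ℂ] D.E i)) := by
    intro i j
    rw [Algebra.TensorProduct.tmul_mul_tmul, Algebra.TensorProduct.tmul_mul_tmul, h.K_E,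
      D.qi_zpow_symm j i, TensorProduct.tmul_smul, smul_smul, ← zpow_add₀ (D.qi_ne i)]
    simp
  have hF : ∀ i j, (D.F i ⊗ₜ[ℂ] 1 : D.U ⊗[ℂ] D.U) * (D.Kinv j ⊗ₜ[ℂ] D.F j) =
      (D.qi i ^ (-D.a i j)) • ((D.Kinv j ⊗ₜ[ℂ] D.F j) * (D.F i ⊗ₜ[ℂ] 1)) := by
    intro i j
    rw [Algebra.TensorProduct.tmul_mul_tmul, Algebra.TensorProduct.tmul_mul_tmul, h.L_F,
      D.qi_zpow_symm j i, ← TensorProduct.smul_tmul', smul_smul, ← zpow_add₀ (D.qi_ne i)]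
    simp
  have flip : ∀ (i j : ι) (x y : D.U ⊗[ℂ] D.U) , x * y = (D.qi i ^ (-D.a i j)) • (y * x) →
      y * x = (D.qi i ^ (D.a i j)) • (x * y) := by
    intro i j x y hxy
    rw [hxy, smul_smul, ← zpow_add₀ (D.qi_ne i)]; simp
  constructor
  · intro i; simp [h.K_mul_L, Algebra.TensorProduct.one_def]
  · intro i; simp [h.L_mul_K, Algebra.TensorProduct.one_def]
  · intro i j; simp [h.K_comm i j]
  · intro i j
    simp only [mul_add, add_mul, Algebra.TensorProduct.tmul_mul_tmul, h.K_E_L, mul_one,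
      h.K_mul_L, h.K_comm i j, smul_add, TensorProduct.smul_tmul', TensorProduct.tmul_smul]
    simp only [mul_assoc, h.K_mul_L, mul_one]
  · intro i j
    simp only [mul_add, add_mul, Algebra.TensorProduct.tmul_mul_tmul, h.K_F_L, mul_one,
      h.K_mul_L, h.K_L_comm i j, smul_add, TensorProduct.smul_tmul', TensorProduct.tmul_smul]
    simp only [mul_assoc, h.K_mul_L, mul_one]
  · intro i
    have e1 := flip i i _ _ (hE i i)
    have e2 := hF i i
    have c1 : (D.E i ⊗ₜ[ℂ] D.K i : D.U ⊗[ℂ] D.U) * (D.Kinv i ⊗ₜ[ℂ] D.F i) =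
        (D.Kinv i ⊗ₜ[ℂ] D.F i) * (D.E i ⊗ₜ[ℂ] D.K i) := by
      rw [Algebra.TensorProduct.tmul_mul_tmul, Algebra.TensorProduct.tmul_mul_tmul, h.K_F, h.L_E,
        TensorProduct.tmul_smul, ← TensorProduct.smul_tmul']
    have c2 : (1 ⊗ₜ[ℂ] D.E i : D.U ⊗[ℂ] D.U) * (D.F i ⊗ₜ[ℂ] 1) =
        (D.F i ⊗ₜ[ℂ] 1) * (1 ⊗ₜ[ℂ] D.E i) := by simp
    have s1 : (D.E i ⊗ₜ[ℂ] D.K i : D.U ⊗[ℂ] D.U) * (D.F i ⊗ₜ[ℂ] 1) -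
        (D.F i ⊗ₜ[ℂ] 1) * (D.E i ⊗ₜ[ℂ] D.K i) =
        (D.qi i - (D.qi i)⁻¹)⁻¹ • ((D.K i - D.Kinv i) ⊗ₜ[ℂ] D.K i) := by
      rw [TensorProduct.smul_tmul', ← h.E_F_same, TensorProduct.sub_tmul]; simp
    have s2 : (1 ⊗ₜ[ℂ] D.E i : D.U ⊗[ℂ] D.U) * (D.Kinv i ⊗ₜ[ℂ] D.F i) -
        (D.Kinv i ⊗ₜ[ℂ] D.F i) * (1 ⊗ₜ[ℂ] D.E i) =
        (D.qi i - (D.qi i)⁻¹)⁻¹ • (D.Kinv i ⊗ₜ[ℂ] (D.K i - D.Kinv i)) := by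
      rw [← TensorProduct.tmul_smul, ← h.E_F_same, TensorProduct.tmul_sub]; simp
    have t : (D.K i ⊗ₜ[ℂ] D.K i - D.Kinv i ⊗ₜ[ℂ] D.Kinv i : D.U ⊗[ℂ] D.U) =
        (D.K i - D.Kinv i) ⊗ₜ[ℂ] D.K i + D.Kinv i ⊗ₜ[ℂ] (D.K i - D.Kinv i) := by
      rw [TensorProduct.sub_tmul, TensorProduct.tmul_sub]; abel
    rw [t, smul_add, ← s1, ← s2, mul_add, add_mul, add_mul, mul_add, add_mul, add_mul, c1, c2]
    abel
  · intro i j hij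
    have c1 : (D.E i ⊗ₜ[ℂ] D.K i : D.U ⊗[ℂ] D.U) * (D.Kinv j ⊗ₜ[ℂ] D.F j) =
        (D.Kinv j ⊗ₜ[ℂ] D.F j) * (D.E i ⊗ₜ[ℂ] D.K i) := by
      rw [Algebra.TensorProduct.tmul_mul_tmul, Algebra.TensorProduct.tmul_mul_tmul, h.K_F, h.L_E,
        TensorProduct.tmul_smul, ← TensorProduct.smul_tmul', zpow_neg, zpow_neg,
        D.qi_zpow_symm i j]
    have c2 : (1 ⊗ₜ[ℂ] D.E i : D.U ⊗[ℂ] D.U) * (D.F j ⊗ₜ[ℂ] 1) =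
        (D.F j ⊗ₜ[ℂ] 1) * (1 ⊗ₜ[ℂ] D.E i) := by simp
    have s1 : (D.E i ⊗ₜ[ℂ] D.K i : D.U ⊗[ℂ] D.U) * (D.F j ⊗ₜ[ℂ] 1) -
        (D.F j ⊗ₜ[ℂ] 1) * (D.E i ⊗ₜ[ℂ] D.K i) = 0 := by
      rw [Algebra.TensorProduct.tmul_mul_tmul, Algebra.TensorProduct.tmul_mul_tmul, mul_one,
        one_mul, ← TensorProduct.sub_tmul, h.E_F_ne i j hij, TensorProduct.zero_tmul]
    have s2 : (1 ⊗ₜ[ℂ] D.E i : D.U ⊗[ℂ] D.U) * (D.Kinv j ⊗ₜ[ℂ] D.F j) -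
        (D.Kinv j ⊗ₜ[ℂ] D.F j) * (1 ⊗ₜ[ℂ] D.E i) = 0 := by
      rw [Algebra.TensorProduct.tmul_mul_tmul, Algebra.TensorProduct.tmul_mul_tmul, mul_one,
        one_mul, ← TensorProduct.tmul_sub, h.E_F_ne i j hij, TensorProduct.tmul_zero]
    rw [mul_add, add_mul, add_mul, mul_add, add_mul, add_mul, c1, c2, sub_eq_zero.mp s1,
      sub_eq_zero.mp s2]
    abel
  · intro i j hij
    obtain ⟨M, hM, hM'⟩ := D.exists_a hij
    have b1 := hE i i
    have b2 := hE i j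
    have b3 := hE j i
    rw [zpow_neg, ← D.qi_zpow_symm, ← zpow_neg] at b3
    replace b3 := flip i j _ _ b3
    rw [D.a_diag, zpow_neg, ← inv_zpow] at b1
    rw [hM, neg_neg, zpow_natCast] at b2
    rw [hM, zpow_neg, ← inv_zpow, zpow_natCast] at b3
    rw [hM', serreSum_add_add (D.generic_qi i) b1 b2 b3, serreSum_tmul_left _ _ _ _ (h.K_comm i j),
      serreSum_tmul_right _ _ _ _ rfl, ← hM', h.serre_E i j hij, TensorProduct.zero_tmul,
      TensorProduct.tmul_zero, add_zero]
  · intro i j hij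
    obtain ⟨M, hM, hM'⟩ := D.exists_a hij
    have b1 := hF i i
    have b2 := hF i j
    have b3 := hF j i
    rw [zpow_neg, ← D.qi_zpow_symm, ← zpow_neg] at b3
    replace b3 := flip i j _ _ b3
    rw [D.a_diag, zpow_neg, ← inv_zpow] at b1
    rw [hM, neg_neg, zpow_natCast] at b2
    rw [hM, zpow_neg, ← inv_zpow, zpow_natCast] at b3
    rw [hM', add_comm (D.F i ⊗ₜ[ℂ] 1), add_comm (D.F j ⊗ₜ[ℂ] 1),
      serreSum_add_add (D.generic_qi i) b1 b2 b3, serreSum_tmul_left _ _ _ _ rfl,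
      serreSum_tmul_right _ _ _ _ (h.L_comm i j), ← hM', h.serre_F i j hij,
      TensorProduct.zero_tmul, TensorProduct.tmul_zero, add_zero]

/-- The coproduct of `U_q(𝔤)`. -/
def comul : D.U →ₐ[ℂ] D.U ⊗[ℂ] D.U := lift D.realizes_comul

theorem EL_mul_KF (i : ι) : D.E i * D.Kinv i * (D.K i * D.F i) = D.E i * D.F i := by
  rw [mul_assoc, ← mul_assoc (D.Kinv i), D.realizes_U.L_mul_K, one_mul]

theorem KF_mul_EL (i : ι) : D.K i * D.F i * (D.E i * D.Kinv i) = D.F i * D.E i := by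
  rw [D.realizes_U.K_F, smul_mul_assoc, mul_assoc, ← mul_assoc (D.K i), D.realizes_U.K_E_L,
    mul_smul_comm, smul_smul, ← zpow_add₀ (D.qi_ne i)]
  simp

theorem KF_comm_EL {i j : ι} (hij : i ≠ j) :
    D.K j * D.F j * (D.E i * D.Kinv i) = D.E i * D.Kinv i * (D.K j * D.F j) := by
  have h := D.realizes_U
  have hEF := sub_eq_zero.mp (h.E_F_ne i j hij)
  have e1 : D.K j * D.F j * (D.E i * D.Kinv i) =
      (D.qi j ^ (-D.a j j) * D.qi j ^ (D.a j i)) • (D.F j * D.E i * (D.K j * D.Kinv i)) := by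
    rw [h.K_F, smul_mul_assoc, mul_assoc, ← mul_assoc (D.K j), h.K_E, smul_mul_assoc,
      mul_smul_comm, smul_smul]
    simp only [mul_assoc]
  have e2 : D.E i * D.Kinv i * (D.K j * D.F j) =
      (D.qi j ^ (-D.a j j) * D.qi i ^ (D.a i j)) • (D.E i * D.F j * (D.Kinv i * D.K j)) := by
    rw [h.K_F, mul_smul_comm, mul_assoc, ← mul_assoc (D.Kinv i), h.L_F, smul_mul_assoc,
      mul_smul_comm, smul_smul]
    simp only [mul_assoc]
  rw [e1, e2, hEF, h.K_L_comm, D.qi_zpow_symm i j]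

theorem serre_EL {i j : ι} (hij : i ≠ j) :
    serreSum (D.qi i) (1 - D.a i j).toNat (D.E i * D.Kinv i) (D.E j * D.Kinv j) = 0 := by
  have h := D.realizes_U
  refine serreSum_twist (D.generic_qi i) (h.L_E i i) (h.L_E i j) ?_ (h.L_comm i j)
    (h.serre_E i j hij)
  rw [h.L_E, zpow_neg, ← D.qi_zpow_symm, ← zpow_neg]

theorem serre_KF {i j : ι} (hij : i ≠ j) :
    serreSum (D.qi i) (1 - D.a i j).toNat (D.K i * D.F i) (D.K j * D.F j) = 0 := by
  have h := D.realizes_U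
  have : serreSum (D.qi i) (1 - D.a i j).toNat (D.F i * D.K i) (D.F j * D.K j) = 0 := by
    refine serreSum_twist (D.generic_qi i) (h.K_F i i) (h.K_F i j) ?_ (h.K_comm i j)
      (h.serre_F i j hij)
    rw [h.K_F, zpow_neg, ← D.qi_zpow_symm, ← zpow_neg]
  rw [h.K_F i i, h.K_F j j, serreSum_smul, this, smul_zero]

open MulOpposite in
/-- `S(K_i) = K_i⁻¹`, `S(E_i) = -E_i K_i⁻¹`, `S(F_i) = -K_i F_i` satisfy the defining relations
in the opposite algebra. -/
theorem realizes_antipode : D.Realizes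
    (fun i => op (-(D.E i * D.Kinv i))) (fun i => op (-(D.K i * D.F i)))
    (fun i => op (D.Kinv i)) (fun i => op (D.K i)) := by
  have h := D.realizes_U
  constructor
  · intro i; rw [← op_mul, h.K_mul_L, op_one]
  · intro i; rw [← op_mul, h.L_mul_K, op_one]
  · intro i j; rw [← op_mul, ← op_mul, h.L_comm]
  · intro i j
    rw [← op_mul, ← op_mul, ← op_smul]
    congr 1
    rw [neg_mul, mul_neg, smul_neg, mul_assoc (D.E j), h.L_comm, ← mul_assoc (D.E j),
      ← mul_assoc (D.K i), ← mul_assoc (D.K i), h.K_E_L, smul_mul_assoc]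
  · intro i j
    rw [← op_mul, ← op_mul, ← op_smul]
    congr 1
    rw [neg_mul, mul_neg, smul_neg, mul_assoc (D.K j), ← mul_assoc (D.K i), h.K_comm, mul_assoc,
      ← mul_assoc (D.K i), h.K_F_L, mul_smul_comm]
  · intro i
    rw [← op_mul, ← op_mul, ← op_sub, ← op_sub, ← op_smul]
    congr 1
    rw [neg_mul_neg, neg_mul_neg, EL_mul_KF, KF_mul_EL, ← neg_sub, h.E_F_same, ← smul_neg, neg_sub]
  · intro i j hij
    rw [← op_mul, ← op_mul, ← op_sub, neg_mul_neg, neg_mul_neg, D.KF_comm_EL hij, sub_self, op_zero]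
  · intro i j hij
    rw [serreSum_op, ← neg_one_smul ℂ (D.E i * _), ← neg_one_smul ℂ (D.E j * _), serreSum_smul,
      D.serre_EL hij, smul_zero, op_zero, smul_zero]
  · intro i j hij
    rw [serreSum_op, ← neg_one_smul ℂ (D.K i * _), ← neg_one_smul ℂ (D.K j * _), serreSum_smul,
      D.serre_KF hij, smul_zero, op_zero, smul_zero]

/-- The antipode of `U_q(𝔤)`. -/
def antipode : D.U →ₗ[ℂ] D.U :=
  (MulOpposite.opLinearEquiv ℂ).symm.toLinearMap ∘ₗ (lift D.realizes_antipode).toLinearMap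

open MulOpposite in
/-- `K_i^* = K_i`, `E_i^* = K_i F_i`, `F_i^* = E_i K_i⁻¹` satisfy the defining relations
in the opposite algebra. -/
theorem realizes_star : D.Realizes
    (fun i => op (D.K i * D.F i)) (fun i => op (D.E i * D.Kinv i))
    (fun i => op (D.K i)) (fun i => op (D.Kinv i)) := by
  have h := D.realizes_U
  constructor
  · intro i; rw [← op_mul, h.L_mul_K, op_one]
  · intro i; rw [← op_mul, h.K_mul_L, op_one]
  · intro i j; rw [← op_mul, ← op_mul, h.K_comm]
  · intro i j
    rw [← op_mul, ← op_mul, ← op_smul]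
    congr 1
    rw [mul_assoc (D.K j), ← mul_assoc (D.Kinv i), ← h.K_L_comm, mul_assoc, ← mul_assoc (D.Kinv i),
      h.L_F, smul_mul_assoc, mul_smul_comm, mul_assoc (D.F j), h.L_mul_K, mul_one]
  · intro i j
    rw [← op_mul, ← op_mul, ← op_smul]
    congr 1
    rw [mul_assoc (D.E j), ← h.K_L_comm, ← mul_assoc, ← mul_assoc, h.L_E, smul_mul_assoc,
      mul_assoc (D.E j), h.L_mul_K, mul_one, smul_mul_assoc]
  · intro i
    rw [← op_mul, ← op_mul, ← op_sub, ← op_sub, ← op_smul]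
    congr 1
    rw [EL_mul_KF, KF_mul_EL, h.E_F_same]
  · intro i j hij
    rw [← op_mul, ← op_mul, ← op_sub, D.KF_comm_EL hij.symm, sub_self, op_zero]
  · intro i j hij
    rw [serreSum_op, D.serre_KF hij, op_zero, smul_zero]
  · intro i j hij
    rw [serreSum_op, D.serre_EL hij, op_zero, smul_zero]

/-- The complex conjugate of an algebra: the same ring, with `c • x` replaced by `conj c • x`. -/
def ConjAlg (A : Type*) : Type _ := A

instance {A : Type*} [Ring A] : Ring (ConjAlg A) := inferInstanceAs (Ring A)

instance {A : Type*} [Ring A] [Algebra ℂ A] : Algebra ℂ (ConjAlg A) :=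
  Algebra.compHom (R := ℂ) A (starRingEnd ℂ)

theorem conj_smul_def {A : Type*} [Ring A] [Algebra ℂ A] (c : ℂ) (x : A) :
    HSMul.hSMul (β := ConjAlg A) (γ := ConjAlg A) c x = (starRingEnd ℂ c • x : A) := rfl

theorem conj_qi (i : ι) : starRingEnd ℂ (D.qi i) = D.qi i := Complex.conj_ofReal _

theorem conj_serre_coeff (i : ι) (n r : ℕ) :
    starRingEnd ℂ ((-1) ^ r * qBinom (D.qi i) n r) = (-1) ^ r * qBinom (D.qi i) n r := by
  have h : ∀ m, starRingEnd ℂ (qFact (D.qi i) m) = qFact (D.qi i) m := by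
    intro m; simp [qFact, qInt, map_prod, conj_qi]
  unfold qBinom
  split_ifs <;> simp [h]

theorem conj_serreSum {A : Type*} [Ring A] [Algebra ℂ A] (i : ι) (N : ℕ) (e f : A) :
    serreSum (A := ConjAlg A) (D.qi i) N e f = serreSum (A := A) (D.qi i) N e f := by
  unfold serreSum
  refine Finset.sum_congr rfl fun r _ => ?_
  conv_rhs => rw [← conj_serre_coeff]
  rfl

theorem Realizes.conj {A : Type*} [Ring A] [Algebra ℂ A] {E F K L : ι → A}
    (h : D.Realizes E F K L) : D.Realizes (A := ConjAlg A) E F K L where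
  K_mul_L := h.K_mul_L
  L_mul_K := h.L_mul_K
  K_comm := h.K_comm
  K_E_L i j := by
    refine (h.K_E_L i j).trans ?_
    rw [conj_smul_def, map_zpow₀, conj_qi]
  K_F_L i j := by
    refine (h.K_F_L i j).trans ?_
    rw [conj_smul_def, map_zpow₀, conj_qi]
  E_F_same i := by
    refine (h.E_F_same i).trans ?_
    have e := conj_smul_def (D.qi i - (D.qi i)⁻¹)⁻¹ (K i - L i)
    rw [map_inv₀, map_sub, map_inv₀, conj_qi] at e
    exact e.symm
  E_F_ne := h.E_F_ne
  serre_E i j hij := (D.conj_serreSum i _ _ _).trans (h.serre_E i j hij)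
  serre_F i j hij := (D.conj_serreSum i _ _ _).trans (h.serre_F i j hij)

/-- The `*`-operation of the compact real form of `U_q(𝔤)`: the conjugate-linear
antiautomorphism with `K_i^* = K_i`, `E_i^* = K_i F_i`, `F_i^* = E_i K_i⁻¹`. -/
def starU : D.U →ₛₗ[starRingEnd ℂ] D.U where
  toFun X := MulOpposite.unop (α := D.U)
    (show D.Uᵐᵒᵖ from lift (A := ConjAlg D.Uᵐᵒᵖ) (Realizes.conj D D.realizes_star) X)
  map_add' X Y := by rw [map_add]; rfl
  map_smul' c X := by rw [map_smul]; rfl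

end Hopf

theorem comul_E (i : ι) : D.comul (D.E i) = D.E i ⊗ₜ[ℂ] D.K i + 1 ⊗ₜ[ℂ] D.E i := lift_gen _ _

theorem comul_F (i : ι) : D.comul (D.F i) = D.F i ⊗ₜ[ℂ] 1 + D.Kinv i ⊗ₜ[ℂ] D.F i :=
  lift_gen _ _

theorem comul_K (i : ι) : D.comul (D.K i) = D.K i ⊗ₜ[ℂ] D.K i := lift_gen _ _

theorem antipode_E (i : ι) : D.antipode (D.E i) = -(D.E i * D.Kinv i) :=
  congrArg MulOpposite.unop (lift_gen D.realizes_antipode (.E i))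

theorem antipode_F (i : ι) : D.antipode (D.F i) = -(D.K i * D.F i) :=
  congrArg MulOpposite.unop (lift_gen D.realizes_antipode (.F i))

theorem antipode_K (i : ι) : D.antipode (D.K i) = D.Kinv i :=
  congrArg MulOpposite.unop (lift_gen D.realizes_antipode (.K i))

theorem antipode_mul (X Y : D.U) : D.antipode (X * Y) = D.antipode Y * D.antipode X :=
  congrArg MulOpposite.unop (map_mul (lift D.realizes_antipode) X Y)

theorem starU_E (i : ι) : D.starU (D.E i) = D.K i * D.F i :=
  congrArg (MulOpposite.unop (α := D.U)) (lift_gen (Realizes.conj D D.realizes_star) (.E i))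

theorem starU_F (i : ι) : D.starU (D.F i) = D.E i * D.Kinv i :=
  congrArg (MulOpposite.unop (α := D.U)) (lift_gen (Realizes.conj D D.realizes_star) (.F i))

theorem starU_K (i : ι) : D.starU (D.K i) = D.K i :=
  congrArg (MulOpposite.unop (α := D.U)) (lift_gen (Realizes.conj D D.realizes_star) (.K i))

theorem starU_mul (X Y : D.U) : D.starU (X * Y) = D.starU Y * D.starU X :=
  congrArg (MulOpposite.unop (α := D.U)) (map_mul (lift (Realizes.conj D D.realizes_star)) X Y)

/-- `K_i` as a unit. -/
def unitK (i : ι) : D.Uˣ := ⟨D.K i, D.Kinv i, D.realizes_U.K_mul_L i, D.realizes_U.L_mul_K i⟩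

/-- `K_λ = ∏ K_i ^ n_i` for `λ = ∑ n_i α_i` in the root lattice. -/
def Kroot [Fintype ι] (n : ι → ℤ) : D.U :=
  ((Finset.univ.noncommProd (fun i => D.unitK i ^ n i) (fun i _ j _ _ =>
    Commute.zpow_zpow (Units.ext (D.realizes_U.K_comm i j)) _ _) : D.Uˣ) : D.U)

/-! ### Representations -/

section Rep

variable {D} {V : Type*} [AddCommGroup V] [Module ℂ V]

/-- The weight space of weight `μ`, where `μ` is given by its coordinates `μ i = ⟨μ, α_i^∨⟩`
in the basis of fundamental weights; `K_i` acts on it by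
`q ^ (α_i, μ) = q ^ (d_i ⟨μ, α_i^∨⟩) = q_i ^ (μ i)`. -/
def weightSpace (π : D.U →ₐ[ℂ] Module.End ℂ V) (μ : ι → ℤ) : Submodule ℂ V :=
  ⨅ i, Module.End.eigenspace (π (D.K i)) (D.qi i ^ μ i)

/-- Representations (of type 1) that are the sum of their weight spaces. -/
def IsTypeOne (π : D.U →ₐ[ℂ] Module.End ℂ V) : Prop := ⨆ μ : ι → ℤ, weightSpace π μ = ⊤

/-- `π` is the irreducible representation `V(Λ)` with dominant integral highest weight `Λ`. -/
structure IsIrrepOfHighestWeight (π : D.U →ₐ[ℂ] Module.End ℂ V) (Λ : ι → ℤ) : Prop where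
  dominant : ∀ i, 0 ≤ Λ i
  exists_highest : ∃ v ∈ weightSpace π Λ, v ≠ 0 ∧ ∀ i, π (D.E i) v = 0
  irreducible : ∀ W : Submodule ℂ V, (∀ X, ∀ w ∈ W, π X w ∈ W) → W = ⊥ ∨ W = ⊤

/-- The inner product of `V` is invariant: `X^*` acts as the adjoint of `X`. -/
def IsUnitary {V : Type*} [NormedAddCommGroup V] [InnerProductSpace ℂ V]
    (π : D.U →ₐ[ℂ] Module.End ℂ V) : Prop :=
  ∀ (X : D.U) (v w : V), inner ℂ (π X v) w = inner ℂ v (π (D.starU X) w)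

/-- The matrix coefficient `X ↦ f (X ▷ v)`. -/
def matrixCoeff (π : D.U →ₐ[ℂ] Module.End ℂ V) (f : Module.Dual ℂ V) (v : V) :
    Module.Dual ℂ D.U :=
  f ∘ₗ LinearMap.applyₗ v ∘ₗ π.toLinearMap

end Rep

/-! ### The quantized coordinate ring -/

/-- The quantized coordinate ring `ℂ_q[G]`: the span in the dual of `U_q(𝔤)` of the matrix
coefficients of finite-dimensional representations (of type 1, realized on `ℂ ^ n`). -/
def coordRing : Submodule ℂ (Module.Dual ℂ D.U) :=
  Submodule.span ℂ {φ | ∃ (n : ℕ) (π : D.U →ₐ[ℂ] Module.End ℂ (Fin n → ℂ)), IsTypeOne π ∧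
    ∃ f v, φ = matrixCoeff π f v}

variable {D} in
/-- The product `(φ ψ)(X) = (φ ⊗ ψ)(Δ(X))`. -/
def dualMul (φ ψ : Module.Dual ℂ D.U) : Module.Dual ℂ D.U :=
  LinearMap.mul' ℂ ℂ ∘ₗ TensorProduct.map φ ψ ∘ₗ D.comul.toLinearMap

variable {D} in
/-- The `*`-operation `φ^*(X) = conj (φ (S(X)^*))`. -/
def dualStar (φ : Module.Dual ℂ D.U) : Module.Dual ℂ D.U where
  toFun X := starRingEnd ℂ (φ (D.starU (D.antipode X)))
  map_add' X Y := by simp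
  map_smul' c X := by simp

variable {D} in
/-- The left action `(X ▷ φ)(Y) = φ(Y X)`. -/
def leftAct (X : D.U) (φ : Module.Dual ℂ D.U) : Module.Dual ℂ D.U := φ ∘ₗ LinearMap.mulRight ℂ X

variable {D} in
/-- The right action `(φ ◁ X)(Y) = φ(X Y)`. -/
def rightAct (φ : Module.Dual ℂ D.U) (X : D.U) : Module.Dual ℂ D.U := φ ∘ₗ LinearMap.mulLeft ℂ X

/-- `ℂ_q[G/T] = {a ∈ ℂ_q[G] : K_λ ▷ a = a for all λ}`. -/
def flagGT [Fintype ι] : Set (Module.Dual ℂ D.U) :=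
  {a | a ∈ D.coordRing ∧ ∀ n : ι → ℤ, leftAct (D.Kroot n) a = a}

/-- `ℂ_q[T\G] = {a ∈ ℂ_q[G] : a ◁ K_λ = a for all λ}`. -/
def flagTG [Fintype ι] : Set (Module.Dual ℂ D.U) :=
  {a | a ∈ D.coordRing ∧ ∀ n : ι → ℤ, rightAct a (D.Kroot n) = a}

section MatrixUnits

variable {D} {V κ : Type*} [NormedAddCommGroup V] [InnerProductSpace ℂ V] [Fintype κ]

/-- The matrix coefficients `u^i_j = f^i(X ▷ v_j)` in an orthonormal basis. -/
def u (π : D.U →ₐ[ℂ] Module.End ℂ V) (v : OrthonormalBasis κ ℂ V) (i j : κ) :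
    Module.Dual ℂ D.U :=
  matrixCoeff π (v.toBasis.coord i) (v j)

/-- The matrix unit `M^n_m`, with entries `(M^n_m)^i_j = (u^m_i)^* u^n_j`. -/
def matM (π : D.U →ₐ[ℂ] Module.End ℂ V) (v : OrthonormalBasis κ ℂ V) (n m : κ) :
    Matrix κ κ (Module.Dual ℂ D.U) :=
  Matrix.of fun i j => dualMul (dualStar (u π v m i)) (u π v n j)

/-- The matrix unit `N^n_m`, with entries `(N^n_m)^i_j = u^i_m (u^j_n)^*`. -/
def matN (π : D.U →ₐ[ℂ] Module.End ℂ V) (v : OrthonormalBasis κ ℂ V) (n m : κ) :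
    Matrix κ κ (Module.Dual ℂ D.U) :=
  Matrix.of fun i j => dualMul (u π v i m) (dualStar (u π v j n))

/-- `P = ∑ c^m_n M^n_m`, where `c m n = c^m_n`. -/
def matP (π : D.U →ₐ[ℂ] Module.End ℂ V) (v : OrthonormalBasis κ ℂ V) (c : κ → κ → ℂ) :
    Matrix κ κ (Module.Dual ℂ D.U) :=
  ∑ m, ∑ n, c m n • matM π v n m

/-- `Q = ∑ c^m_n N^n_m`, where `c m n = c^m_n`. -/
def matQ (π : D.U →ₐ[ℂ] Module.End ℂ V) (v : OrthonormalBasis κ ℂ V) (c : κ → κ → ℂ) :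
    Matrix κ κ (Module.Dual ℂ D.U) :=
  ∑ m, ∑ n, c m n • matN π v n m

end MatrixUnits

end Datum

/-! ### The Cartan datum and the weights of a simple Lie algebra -/

section LieData

open LieAlgebra LieAlgebra.IsKilling

variable {𝔤 : Type*} [LieRing 𝔤] [LieAlgebra ℂ 𝔤] [FiniteDimensional ℂ 𝔤]
  [LieAlgebra.IsSimple ℂ 𝔤] (H : LieSubalgebra ℂ 𝔤) [H.IsCartanSubalgebra]

/-- The form on `𝔥^*` induced by the Killing form. -/
def killingDual (x y : Module.Dual ℂ H) : ℂ :=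
  killingForm ℂ 𝔤 ((cartanEquivDual H).symm x) ((cartanEquivDual H).symm y)

/-- The (positive) squared length of the shortest roots for the form induced by the Killing
form. -/
def shortNormSq : ℝ :=
  ⨅ α : H.root, (killingDual H ((rootSystem H).root α) ((rootSystem H).root α)).re

/-- The form `(·, ·)` on `𝔥^*`: the multiple of the form induced by the Killing form with
`(α, α) = 2` for every short root `α`. -/
def normForm (x y : Module.Dual ℂ H) : ℂ := (2 / shortNormSq H : ℝ) * killingDual H x y

theorem killingDual_eq (x y : Module.Dual ℂ H) :
    killingDual H x y = x ((cartanEquivDual H).symm y) := by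
  have : cartanEquivDual H ((cartanEquivDual H).symm x) ((cartanEquivDual H).symm y) =
      x ((cartanEquivDual H).symm y) := by rw [LinearEquiv.apply_symm_apply]
  rw [← this]
  rfl

theorem killingDual_comm (x y : Module.Dual ℂ H) : killingDual H x y = killingDual H y x :=
  LieModule.traceForm_comm ..

theorem root_coroot (α β : H.root) :
    2 * killingDual H ((rootSystem H).root β) ((rootSystem H).root α) =
      (rootSystem H).pairingIn ℤ β α *
        killingDual H ((rootSystem H).root α) ((rootSystem H).root α) := by
  have h := root_apply_cartanEquivDual_symm_ne_zero (H.isNonZero_coe_root α)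
  have e : (((rootSystem H).pairingIn ℤ β α : ℤ) : ℂ) = (rootSystem H).pairing β α :=
    (rootSystem H).algebraMap_pairingIn ℤ β α
  rw [e, killingDual_eq, killingDual_eq, rootSystem_pairing_apply, coroot]
  simp only [rootSystem_root_apply, map_nsmul, map_smul, nsmul_eq_mul, smul_eq_mul]
  field_simp
  simp only [LieModule.Weight.toLinear_apply]
  push_cast
  ring

theorem killingDual_root_pos (α : H.root) :
    0 < (killingDual H ((rootSystem H).root α) ((rootSystem H).root α)).re := by
  have h := root_apply_cartanEquivDual_symm_ne_zero (H.isNonZero_coe_root α)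
  have h2 := root_apply_coroot (H.isNonZero_coe_root α)
  have hT := traceForm_coroot (K := ℂ) (L := 𝔤) (α : LieModule.Weight ℂ H 𝔤) (coroot α)
  have hS : LieModule.traceForm ℂ H 𝔤 (coroot (α : LieModule.Weight ℂ H 𝔤)) (coroot α) =
      ((∑ β : H.root, (rootSystem H).pairingIn ℤ β α * (rootSystem H).pairingIn ℤ β α : ℤ) : ℂ) := by
    rw [← LieAlgebra.restrict_killingForm, restrict_killingForm_eq_sum, ← Finset.sum_coe_sort]
    have e : ∀ β : H.root, (((rootSystem H).pairingIn ℤ β α : ℤ) : ℂ) = 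
        (β : LieModule.Weight ℂ H 𝔤) (coroot (α : LieModule.Weight ℂ H 𝔤)) := fun β =>
      (rootSystem H).algebraMap_pairingIn ℤ β α
    simp [e, LinearMap.sum_apply]
  have hpos : 0 < ∑ β : H.root,
      (rootSystem H).pairingIn ℤ β α * (rootSystem H).pairingIn ℤ β α := by
    refine Finset.sum_pos' (fun β _ => mul_self_nonneg _) ⟨α, Finset.mem_univ _, ?_⟩
    rw [RootPairing.pairingIn_same]
    norm_num
  have hT' := hS.symm.trans hT
  rw [h2] at hT'
  generalize (∑ β : H.root,
      (rootSystem H).pairingIn ℤ β α * (rootSystem H).pairingIn ℤ β α) = T at hT' hpos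
  rw [killingDual_eq]
  change 0 < ((α : LieModule.Weight ℂ H 𝔤) ((cartanEquivDual H).symm
    (α : LieModule.Weight ℂ H 𝔤).toLinear)).re
  have hTr : (0 : ℝ) < T := by exact_mod_cast hpos
  generalize (α : LieModule.Weight ℂ H 𝔤) ((cartanEquivDual H).symm
    (α : LieModule.Weight ℂ H 𝔤).toLinear) = s at h hT' ⊢
  have hs : s = ((4 / (T : ℝ) : ℝ) : ℂ) := by
    have : (T : ℂ) ≠ 0 := by exact_mod_cast hpos.ne'
    push_cast
    simp only [nsmul_eq_mul, smul_eq_mul] at hT'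
    field_simp at hT' ⊢
    push_cast at hT'
    linear_combination hT'
  rw [hs, Complex.ofReal_re]
  positivity

theorem shortNormSq_pos [Nonempty H.root] : 0 < shortNormSq H := by
  obtain ⟨α, hα⟩ := exists_eq_ciInf_of_finite
    (f := fun α : H.root => (killingDual H ((rootSystem H).root α) ((rootSystem H).root α)).re)
  rw [shortNormSq, ← hα]
  exact killingDual_root_pos H α

variable {H}

/-- The Cartan datum of `𝔤` with respect to the simple roots `α_i`, with
`a i j = 2 (α_i, α_j) / (α_i, α_i) = ⟨α_j, α_i^∨⟩` and `d i = (α_i, α_i) / 2`. -/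
def lieDatum (b : (rootSystem H).Base) (q : ℝ) (hq0 : 0 < q) (hq1 : q ≠ 1) :
    Datum b.support where
  a i j := (rootSystem H).pairingIn ℤ j i
  d i := (normForm H ((rootSystem H).root i) ((rootSystem H).root i)).re / 2
  q := q
  a_diag i := b.cartanMatrix_apply_same i
  a_nonpos i j hij := b.cartanMatrix_le_zero_of_ne j i hij.symm
  d_pos i := by
    have : Nonempty H.root := ⟨i⟩
    rw [normForm, Complex.re_ofReal_mul]
    have := killingDual_root_pos H i
    have := shortNormSq_pos H
    positivity
  d_symm i j := by
    have h1 := congrArg Complex.re (root_coroot H i j)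
    have h2 := congrArg Complex.re (root_coroot H j i)
    rw [killingDual_comm] at h2
    rw [← Complex.ofReal_intCast, Complex.re_ofReal_mul] at h1 h2
    simp only [normForm, Complex.re_ofReal_mul]
    have h3 := h1.symm.trans h2
    linear_combination (1 / shortNormSq H) * h3
  q_pos := hq0
  q_ne_one := hq1

/-- The weight lattice: the `μ ∈ 𝔥^*` with `⟨μ, α_i^∨⟩ ∈ ℤ` for all simple roots `α_i`. -/
def weightLattice (b : (rootSystem H).Base) : AddSubgroup (Module.Dual ℂ H) where
  carrier := {μ | ∀ i : b.support, ∃ n : ℤ, μ ((rootSystem H).coroot i) = n}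
  zero_mem' i := ⟨0, by simp⟩
  add_mem' hμ hν i := by
    obtain ⟨m, hm⟩ := hμ i
    obtain ⟨n, hn⟩ := hν i
    exact ⟨m + n, by rw [LinearMap.add_apply, hm, hn, Int.cast_add]⟩
  neg_mem' hμ i := by
    obtain ⟨m, hm⟩ := hμ i
    exact ⟨-m, by rw [LinearMap.neg_apply, hm, Int.cast_neg]⟩

/-- The coordinates `⟨μ, α_i^∨⟩` of a weight. -/
def weightCoord {b : (rootSystem H).Base} (μ : weightLattice b) (i : b.support) : ℤ :=
  (μ.2 i).choose

theorem weightCoord_spec {b : (rootSystem H).Base} (μ : weightLattice b) (i : b.support) :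
    (weightCoord μ i : ℂ) = μ.1 ((rootSystem H).coroot i) :=
  (μ.2 i).choose_spec.symm

end LieData

end QuantumGroup

end

open scoped TensorProduct
noncomputable section

namespace QuantumGroup

namespace Datum

variable {ι : Type*} {D : Datum ι} {κ τ : Type*} [Fintype κ] [DecidableEq κ] [Fintype τ]
  [DecidableEq τ]

/-! An orthonormal weight basis turns `π` into a matrix representation `R` in which every `K_i` is
diagonal. By unitarity `(u^i_j)^*` is again a matrix entry, namely one of the contragredient
representation `R^*`, whose basis weights are `-λ_k` (`dualStar_u`). Products of matrix entries are
entries of tensor products (`dualMul_entry`). Hence the entries of `P` are the components of the row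
vector `c` times the matrix of `R^* ⊗ R`, and the entries of `Q` are the components of the matrix of
`R ⊗ R^*` times the column vector `c`, where `c` is indexed by pairs `(m, n)`.

For any matrix representation `T` in a weight basis, all components of `X ↦ c T(X)` are invariant
under `◁ K_λ` exactly when `c T(K_λ) = c`. Necessity is evaluation at `X = 1`, and sufficiency is
multiplicativity of `T`; no linear independence of matrix coefficients enters. Since `T(K_λ)` is
diagonal and `q_i` is positive and different from `1`, invariance for all `λ` means that `c` is
supported on basis vectors of weight zero (`HasWeights.row_mem_flagTG_iff`, with the column version
`HasWeights.col_mem_flagGT_iff`). The vector `(m, n)` has weight `λ_n - λ_m` in `R^* ⊗ R` and `λ_m -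
λ_n` in `R ⊗ R^*`, so both conditions become: `c^m_n = 0` unless `λ_m = λ_n`. -/

theorem qi_zpow_eq_one {i : ι} {z : ℤ} : D.qi i ^ z = 1 ↔ z = 0 := by
  have h0 : 0 < D.q ^ D.d i := Real.rpow_pos_of_pos D.q_pos _
  have h1 : D.q ^ D.d i ≠ 1 := by
    -- Since `d_i ≠ 0`, the map `x ↦ x ^ d_i` is injective on nonnegative reals, so `q ^ d_i = 1 ^
    -- d_i` would force `q = 1`.
    rw [Ne, ← Real.one_rpow (D.d i), Real.rpow_left_inj D.q_pos.le zero_le_one (D.d_pos i).ne']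
    exact D.q_ne_one
  rw [← zpow_eq_one_iff_right₀ h0.le h1, qi]
  norm_cast

/-! ### Matrix representations in a weight basis -/

/-- The matrix entry `X ↦ R(X)_{st}` of a matrix representation. -/
def entry (R : D.U →ₐ[ℂ] Matrix κ κ ℂ) (s t : κ) : Module.Dual ℂ D.U :=
  Matrix.entryLinearMap ℂ ℂ s t ∘ₗ R.toLinearMap

@[simp]
theorem entry_apply (R : D.U →ₐ[ℂ] Matrix κ κ ℂ) (s t : κ) (X : D.U) :
    entry R s t X = R X s t := rfl

/-- The `k`-th basis vector is a weight vector of weight `w k` for the matrix representation. -/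
def HasWeights (R : D.U →ₐ[ℂ] Matrix κ κ ℂ) (w : κ → ι → ℤ) : Prop :=
  ∀ i, R (D.K i) = Matrix.diagonal fun k => D.qi i ^ w k i

theorem HasWeights.Kinv {R : D.U →ₐ[ℂ] Matrix κ κ ℂ} {w : κ → ι → ℤ} (h : HasWeights R w)
    (i : ι) : R (D.Kinv i) = Matrix.diagonal fun k => D.qi i ^ (-w k i) := by
  refine left_inv_eq_right_inv (a := R (D.K i)) ?_ ?_
  · rw [← map_mul, D.realizes_U.L_mul_K, map_one]
  · rw [h i, Matrix.diagonal_mul_diagonal]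
    simp only [zpow_neg, mul_inv_cancel₀ (zpow_ne_zero _ (D.qi_ne i)), Matrix.diagonal_one]

/-- `coordRing` only admits representations on `Fin n → ℂ`, so `κ` is enumerated and the matrices
act on the correspondingly reindexed standard basis. -/
theorem HasWeights.entry_mem {R : D.U →ₐ[ℂ] Matrix κ κ ℂ} {w : κ → ι → ℤ}
    (h : HasWeights R w) (s t : κ) : entry R s t ∈ D.coordRing := by
  let e := Fintype.equivFin κ
  let b : Module.Basis κ ℂ (Fin (Fintype.card κ) → ℂ) := (Pi.basisFun ℂ _).reindex e.symm
  refine Submodule.subset_span ⟨_, (Matrix.toLinAlgEquiv b).toAlgHom.comp R, ?_, b.coord s, b t, ?_⟩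
  -- Type 1 holds because each basis vector already lies in a weight space.
  · rw [IsTypeOne, eq_top_iff, ← b.span_eq, Submodule.span_le]
    rintro _ ⟨k, rfl⟩
    refine Submodule.mem_iSup_of_mem (w k) ?_
    simp only [weightSpace, Submodule.mem_iInf, Module.End.mem_eigenspace_iff]
    intro i
    change Matrix.toLinAlgEquiv b (R (D.K i)) (b k) = _
    rw [h i, Matrix.toLinAlgEquiv_self]
    simp [Matrix.diagonal_apply]
  · ext X
    change _ = b.coord s (Matrix.toLinAlgEquiv b (R X) (b t))
    rw [Matrix.toLinAlgEquiv_self]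
    simp [Finsupp.single_apply]

/-- Exponents may be negative, so the computation takes place in unit groups: `R` maps each unit
`K_i` into the image of the commutative group `(κ → ℂ)ˣ` under the diagonal embedding `δ`, where the
product can be evaluated coordinatewise. -/
theorem HasWeights.Kroot [Fintype ι] {R : D.U →ₐ[ℂ] Matrix κ κ ℂ} {w : κ → ι → ℤ}
    (h : HasWeights R w) (n : ι → ℤ) :
    R (D.Kroot n) = Matrix.diagonal fun k => ∏ i, (D.qi i ^ w k i) ^ n i := by
  have hχ : ∀ i k, D.qi i ^ w k i ≠ 0 := fun i k => zpow_ne_zero _ (D.qi_ne i)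
  let χ : ι → (κ → ℂ)ˣ := fun i =>
    ⟨fun k => D.qi i ^ w k i, fun k => D.qi i ^ (-w k i), by ext; simp [hχ],
      by ext; simp [hχ]⟩
  let δ : (κ → ℂ)ˣ →* (Matrix κ κ ℂ)ˣ := Units.map (Matrix.diagonalRingHom κ ℂ).toMonoidHom
  let ρ : D.Uˣ →* (Matrix κ κ ℂ)ˣ := Units.map (R : D.U →* Matrix κ κ ℂ)
  have hρ : ∀ i, ρ (D.unitK i) = δ (χ i) := fun i => Units.ext (h i)
  have hcomm : ((Finset.univ : Finset ι) : Set ι).Pairwise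
      (Function.onFun Commute fun i => D.unitK i ^ n i) := fun i _ j _ _ =>
    Commute.zpow_zpow (Units.ext (D.realizes_U.K_comm i j)) _ _
  have key : ρ (Finset.univ.noncommProd (fun i => D.unitK i ^ n i) hcomm) =
      δ (∏ i, χ i ^ n i) := by
    have hχc : ((Finset.univ : Finset ι) : Set ι).Pairwise
        (Function.onFun Commute fun i => χ i ^ n i) := fun i _ j _ _ => Commute.all _ _
    -- The commutative product is rewritten as a `noncommProd` so that `ρ` and `δ` can both be
    -- pushed inside and the factors compared one by one.
    have hprod : Finset.univ.noncommProd (fun i => χ i ^ n i) hχc = ∏ i, χ i ^ n i :=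
      Finset.noncommProd_eq_prod _ _
    rw [← hprod, Finset.map_noncommProd]
    refine Eq.trans ?_ (Finset.map_noncommProd _ _ hχc δ).symm
    refine Finset.noncommProd_congr rfl (fun i _ => ?_) _
    rw [map_zpow, map_zpow, hρ]
  refine (congrArg Units.val key).trans ?_
  change Matrix.diagonal ((∏ i, χ i ^ n i : (κ → ℂ)ˣ) : κ → ℂ) = _
  congr 1
  ext k
  have := map_prod ((Pi.evalMonoidHom (fun _ : κ => ℂ) k).comp (Units.coeHom _))
    (fun i => χ i ^ n i) Finset.univ
  refine this.trans (Finset.prod_congr rfl fun i _ => ?_)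
  -- Evaluation at `k` is applied on units first; only in the field `ℂ` does the integer power of a
  -- unit become an integer power of its value.
  have h2 := map_zpow (Units.map (Pi.evalMonoidHom (fun _ : κ => ℂ) k)) (χ i) (n i)
  refine (congrArg Units.val h2).trans ?_
  rw [Units.val_zpow_eq_zpow_val]
  rfl

/-! ### Torus invariance of rows and columns of matrix coefficients -/

theorem forall_prod_zpow_iff [Fintype ι] (w : ι → ℤ) (c : ℂ) :
    (∀ n : ι → ℤ, c * ∏ i, (D.qi i ^ w i) ^ n i = c) ↔ (w ≠ 0 → c = 0) := by
  classical
  refine ⟨fun h hw => ?_, fun h n => ?_⟩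
  · obtain ⟨i, hi⟩ := Function.ne_iff.mp hw
    by_contra hc
    -- Testing with `λ = α_i`, where `w i ≠ 0`, leaves the single factor `q_i ^ w i`, which is not
    -- `1`.
    have h1 := h (Pi.single i 1)
    rw [Finset.prod_eq_single i (fun j _ hj => by simp [hj]) (by simp),
      Pi.single_eq_same, zpow_one, mul_eq_left₀ hc, qi_zpow_eq_one] at h1
    exact hi h1
  · by_cases hw : w = 0
    · simp [hw]
    · rw [h hw, zero_mul]

/-- The functionals are the components of `X ↦ c R(X)`. The right action of `K_λ` replaces `c` by `c
R(K_λ)`, so invariance of all components together is the statement that `c` is fixed by every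
diagonal matrix `R(K_λ)`. -/
theorem HasWeights.row_mem_flagTG_iff [Fintype ι] {R : D.U →ₐ[ℂ] Matrix κ κ ℂ} {w : κ → ι → ℤ}
    (h : HasWeights R w) (c : κ → ℂ) :
    (∀ t, ∑ s, c s • entry R s t ∈ D.flagTG) ↔ ∀ s, w s ≠ 0 → c s = 0 := by
  have hval : ∀ t X, (∑ s, c s • entry R s t) X = Matrix.vecMul c (R X) t := fun t X => by
    simp [LinearMap.sum_apply, Matrix.vecMul, dotProduct]
  have hmem : ∀ t, ∑ s, c s • entry R s t ∈ D.coordRing := fun t =>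
    Submodule.sum_mem _ fun s _ => Submodule.smul_mem _ _ (h.entry_mem s t)
  have hinv : (∀ t, ∑ s, c s • entry R s t ∈ D.flagTG) ↔
      ∀ n : ι → ℤ, Matrix.vecMul c (R (D.Kroot n)) = c := by
    refine ⟨fun H n => ?_, fun H t => ⟨hmem t, fun n => ?_⟩⟩
    · ext t
      -- As `R(1)` is the identity, evaluation at `1` recovers the coefficient vector.
      have := LinearMap.congr_fun ((H t).2 n) 1
      change (∑ s, c s • entry R s t) (D.Kroot n * 1) = _ at this
      rwa [hval, hval, mul_one, map_one, Matrix.vecMul_one] at this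
    · ext X
      change (∑ s, c s • entry R s t) (D.Kroot n * X) = _
      rw [hval, hval, map_mul, ← Matrix.vecMul_vecMul, H n]
  simp only [hinv, h.Kroot, funext_iff, Matrix.vecMul_diagonal]
  rw [forall_comm]
  exact forall_congr' fun s => forall_prod_zpow_iff _ _

/-- The mirror image of the row case: `▷` multiplies the argument on the right, so `K_λ` acts on the
column vector in `X ↦ R(X) c`. -/
theorem HasWeights.col_mem_flagGT_iff [Fintype ι] {R : D.U →ₐ[ℂ] Matrix κ κ ℂ} {w : κ → ι → ℤ}
    (h : HasWeights R w) (c : κ → ℂ) :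
    (∀ s, ∑ t, c t • entry R s t ∈ D.flagGT) ↔ ∀ t, w t ≠ 0 → c t = 0 := by
  have hval : ∀ s X, (∑ t, c t • entry R s t) X = Matrix.mulVec (R X) c s := fun s X => by
    simp [LinearMap.sum_apply, Matrix.mulVec, dotProduct, mul_comm]
  have hmem : ∀ s, ∑ t, c t • entry R s t ∈ D.coordRing := fun s =>
    Submodule.sum_mem _ fun t _ => Submodule.smul_mem _ _ (h.entry_mem s t)
  have hinv : (∀ s, ∑ t, c t • entry R s t ∈ D.flagGT) ↔
      ∀ n : ι → ℤ, Matrix.mulVec (R (D.Kroot n)) c = c := by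
    refine ⟨fun H n => ?_, fun H s => ⟨hmem s, fun n => ?_⟩⟩
    · ext s
      have := LinearMap.congr_fun ((H s).2 n) 1
      change (∑ t, c t • entry R s t) (1 * D.Kroot n) = _ at this
      rwa [hval, hval, one_mul, map_one, Matrix.one_mulVec] at this
    · ext X
      change (∑ t, c t • entry R s t) (X * D.Kroot n) = _
      rw [hval, hval, map_mul, ← Matrix.mulVec_mulVec, H n]
  simp only [hinv, h.Kroot, funext_iff, Matrix.mulVec_diagonal, mul_comm _ (c _)]
  rw [forall_comm]
  exact forall_congr' fun s => forall_prod_zpow_iff _ _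

/-! ### Tensor products and contragredients -/

/-- The tensor product of two matrix representations. -/
def tensorRep (R : D.U →ₐ[ℂ] Matrix κ κ ℂ) (R' : D.U →ₐ[ℂ] Matrix τ τ ℂ) :
    D.U →ₐ[ℂ] Matrix (κ × τ) (κ × τ) ℂ :=
  ((Matrix.kroneckerAlgEquiv κ τ ℂ).toAlgHom.comp (Algebra.TensorProduct.map R R')).comp D.comul

theorem dualMul_entry (R : D.U →ₐ[ℂ] Matrix κ κ ℂ) (R' : D.U →ₐ[ℂ] Matrix τ τ ℂ)
    (m i : κ) (n j : τ) :
    dualMul (entry R m i) (entry R' n j) = entry (tensorRep R R') (m, n) (i, j) := by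
  ext X
  change LinearMap.mul' ℂ ℂ (TensorProduct.map (entry R m i) (entry R' n j) (D.comul X)) =
    Matrix.kroneckerAlgEquiv κ τ ℂ (Algebra.TensorProduct.map R R' (D.comul X)) (m, n) (i, j)
  -- Both sides are linear in `Δ(X)`; on a pure tensor the identity is the formula for the entries
  -- of a Kronecker product.
  induction D.comul X with
  | zero => simp
  | tmul x y => simp
  | add x y hx hy => simp only [map_add, hx, hy, Matrix.add_apply]

/-- Weights add because `K_i` is group-like. -/
theorem HasWeights.tensorRep {R : D.U →ₐ[ℂ] Matrix κ κ ℂ} {R' : D.U →ₐ[ℂ] Matrix τ τ ℂ}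
    {w : κ → ι → ℤ} {w' : τ → ι → ℤ} (h : HasWeights R w) (h' : HasWeights R' w') :
    HasWeights (tensorRep R R') fun p => w p.1 + w' p.2 := by
  intro i
  change Matrix.kroneckerAlgEquiv κ τ ℂ (Algebra.TensorProduct.map R R' (D.comul (D.K i))) = _
  rw [comul_K, Algebra.TensorProduct.map_tmul, h i, h' i, Matrix.kroneckerAlgEquiv_apply,
    kroneckerLinearEquiv_tmul, Matrix.diagonal_kronecker_diagonal]
  simp [zpow_add₀ (D.qi_ne i)]

/-- The contragredient of a matrix representation. -/
def dualRep (R : D.U →ₐ[ℂ] Matrix κ κ ℂ) : D.U →ₐ[ℂ] Matrix κ κ ℂ :=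
  (Matrix.transposeAlgEquiv κ ℂ ℂ).symm.toAlgHom.comp
    ((AlgHom.op R).comp (lift D.realizes_antipode))

/-- The antipode and the transpose both reverse products, so their composite with `R` is
multiplicative; this is why the indices are exchanged. -/
theorem dualRep_apply (R : D.U →ₐ[ℂ] Matrix κ κ ℂ) (X : D.U) (i j : κ) :
    dualRep R X i j = R (D.antipode X) j i := rfl

/-- The sign comes from `S(K_i) = K_i⁻¹`; transposition leaves diagonal matrices unchanged. -/
theorem HasWeights.dualRep {R : D.U →ₐ[ℂ] Matrix κ κ ℂ} {w : κ → ι → ℤ} (h : HasWeights R w) :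
    HasWeights (dualRep R) (-w) := by
  intro i
  have e := congrArg Matrix.transpose (h.Kinv i)
  rw [Matrix.diagonal_transpose, ← antipode_K] at e
  exact e

/-! ### Unitary representations and the matrices `P` and `Q` -/

section Unitary

variable {V : Type*} [NormedAddCommGroup V] [InnerProductSpace ℂ V]

/-- The matrix representation given by an orthonormal basis. -/
def matrixRep (π : D.U →ₐ[ℂ] Module.End ℂ V) (v : OrthonormalBasis κ ℂ V) :
    D.U →ₐ[ℂ] Matrix κ κ ℂ :=
  (LinearMap.toMatrixAlgEquiv v.toBasis).toAlgHom.comp π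

theorem matrixRep_apply (π : D.U →ₐ[ℂ] Module.End ℂ V) (v : OrthonormalBasis κ ℂ V) (X : D.U)
    (i j : κ) : matrixRep π v X i j = inner ℂ (v i) (π X (v j)) := by
  change LinearMap.toMatrixAlgEquiv v.toBasis (π X) i j = _
  rw [LinearMap.toMatrixAlgEquiv_apply]
  simp [OrthonormalBasis.repr_apply_apply]

theorem u_eq_entry (π : D.U →ₐ[ℂ] Module.End ℂ V) (v : OrthonormalBasis κ ℂ V) (i j : κ) :
    u π v i j = entry (matrixRep π v) i j := by
  ext X
  rw [entry_apply, matrixRep_apply, ← OrthonormalBasis.repr_apply_apply]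
  rfl

/-- Unitarity removes the star: `conj ⟨v_i, S(X)^* v_j⟩ = conj ⟨S(X) v_i, v_j⟩ = ⟨v_j, S(X) v_i⟩`,
which is a contragredient matrix entry. -/
theorem dualStar_u {π : D.U →ₐ[ℂ] Module.End ℂ V} (hπ : IsUnitary π)
    (v : OrthonormalBasis κ ℂ V) (i j : κ) :
    dualStar (u π v i j) = entry (dualRep (matrixRep π v)) i j := by
  ext X
  rw [entry_apply, dualRep_apply, u_eq_entry]
  change starRingEnd ℂ (matrixRep π v (D.starU (D.antipode X)) i j) = _
  rw [matrixRep_apply, matrixRep_apply, ← hπ, inner_conj_symm]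

theorem hasWeights_matrixRep (π : D.U →ₐ[ℂ] Module.End ℂ V) (v : OrthonormalBasis κ ℂ V)
    {w : κ → ι → ℤ} (hv : ∀ k, v k ∈ weightSpace π (w k)) : HasWeights (matrixRep π v) w := by
  intro i
  ext k l
  have hl := hv l
  simp only [weightSpace, Submodule.mem_iInf, Module.End.mem_eigenspace_iff] at hl
  rw [matrixRep_apply, hl i, inner_smul_right, v.inner_eq_ite, Matrix.diagonal_apply]
  split_ifs with hkl
  · rw [hkl, mul_one]
  · rw [mul_zero]

theorem matP_apply {π : D.U →ₐ[ℂ] Module.End ℂ V} (hπ : IsUnitary π)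
    (v : OrthonormalBasis κ ℂ V) (c : κ → κ → ℂ) (i j : κ) :
    matP π v c i j = ∑ p : κ × κ, c p.1 p.2 •
      entry (tensorRep (dualRep (matrixRep π v)) (matrixRep π v)) p (i, j) := by
  rw [Fintype.sum_prod_type]
  simp only [matP, Matrix.sum_apply, Matrix.smul_apply, matM, Matrix.of_apply, dualStar_u hπ]
  simp only [u_eq_entry, dualMul_entry]

theorem matQ_apply {π : D.U →ₐ[ℂ] Module.End ℂ V} (hπ : IsUnitary π)
    (v : OrthonormalBasis κ ℂ V) (c : κ → κ → ℂ) (i j : κ) :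
    matQ π v c i j = ∑ p : κ × κ, c p.1 p.2 •
      entry (tensorRep (matrixRep π v) (dualRep (matrixRep π v))) (i, j) p := by
  rw [Fintype.sum_prod_type]
  simp only [matQ, Matrix.sum_apply, Matrix.smul_apply, matN, Matrix.of_apply, dualStar_u hπ]
  simp only [u_eq_entry, dualMul_entry]

variable [Fintype ι] {π : D.U →ₐ[ℂ] Module.End ℂ V} {w : κ → ι → ℤ}

/-- The row criterion for `R^* ⊗ R`: the pair `(m, n)` has weight `-w m + w n`, which vanishes
exactly when `w m = w n`. -/
theorem matP_mem_flagTG_iff (hπ : IsUnitary π) (v : OrthonormalBasis κ ℂ V)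
    (hv : ∀ k, v k ∈ weightSpace π (w k)) (c : κ → κ → ℂ) :
    (∀ i j, matP π v c i j ∈ D.flagTG) ↔ ∀ m n, w m ≠ w n → c m n = 0 := by
  have h := hasWeights_matrixRep π v hv
  simpa only [matP_apply hπ, Prod.forall, Pi.neg_apply, Ne, neg_add_eq_zero] using
    (h.dualRep.tensorRep h).row_mem_flagTG_iff fun p => c p.1 p.2

/-- The column criterion for `R ⊗ R^*`, where `(m, n)` has weight `w m - w n`. -/
theorem matQ_mem_flagGT_iff (hπ : IsUnitary π) (v : OrthonormalBasis κ ℂ V)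
    (hv : ∀ k, v k ∈ weightSpace π (w k)) (c : κ → κ → ℂ) :
    (∀ i j, matQ π v c i j ∈ D.flagGT) ↔ ∀ m n, w m ≠ w n → c m n = 0 := by
  have h := hasWeights_matrixRep π v hv
  simpa only [matQ_apply hπ, Prod.forall, Pi.neg_apply, Ne, add_neg_eq_zero] using
    (h.tensorRep h.dualRep).col_mem_flagGT_iff fun p => c p.1 p.2

end Unitary

end Datum

/-! ### From weight coordinates back to weights in `𝔥^*` -/

section LieData

open LieAlgebra LieAlgebra.IsKilling

variable {𝔤 : Type*} [LieRing 𝔤] [LieAlgebra ℂ 𝔤] [FiniteDimensional ℂ 𝔤]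
  [LieAlgebra.IsSimple ℂ 𝔤] {H : LieSubalgebra ℂ 𝔤} [H.IsCartanSubalgebra]

/-- A weight is determined by its coordinates. -/
theorem weightCoord_injective (b : (rootSystem H).Base) :
    Function.Injective (weightCoord (b := b)) := by
  intro μ ν h
  -- The simple coroots span `𝔥`, so a functional is determined by its values on them.
  refine Subtype.ext (LinearMap.ext_on
    (b.span_coroot_support.trans RootPairing.IsRootSystem.span_coroot_eq_top) ?_)
  rintro _ ⟨i, hi, rfl⟩
  have h1 := weightCoord_spec μ ⟨i, hi⟩
  rw [h, weightCoord_spec] at h1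
  exact h1.symm

end LieData

end QuantumGroup

end

open QuantumGroup QuantumGroup.Datum in
theorem mainTheorem9 {𝔤 : Type*} [LieRing 𝔤] [LieAlgebra ℂ 𝔤] [FiniteDimensional ℂ 𝔤]
    [LieAlgebra.IsSimple ℂ 𝔤] (H : LieSubalgebra ℂ 𝔤) [H.IsCartanSubalgebra]
    (b : (LieAlgebra.IsKilling.rootSystem H).Base) (q : ℝ) (hq0 : 0 < q) (hq1 : q ≠ 1)
    {V : Type*} [NormedAddCommGroup V] [InnerProductSpace ℂ V] [FiniteDimensional ℂ V]
    (π : (lieDatum b q hq0 hq1).U →ₐ[ℂ] Module.End ℂ V) (Λ : weightLattice b)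
    (hΛ : IsIrrepOfHighestWeight π (weightCoord Λ)) (hπ : IsUnitary π)
    {κ : Type*} [Fintype κ] (v : OrthonormalBasis κ ℂ V) (wt : κ → weightLattice b)
    (hv : ∀ k, v k ∈ weightSpace π (weightCoord (wt k))) (c : κ → κ → ℂ) :
    ((∀ i j, matP π v c i j ∈ (lieDatum b q hq0 hq1).flagTG) ↔
      ∀ m n, wt m ≠ wt n → c m n = 0) ∧
    ((∀ i j, matQ π v c i j ∈ (lieDatum b q hq0 hq1).flagGT) ↔
      ∀ m n, wt m ≠ wt n → c m n = 0) := by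
  classical
  rw [matP_mem_flagTG_iff hπ v hv, matQ_mem_flagGT_iff hπ v hv]
  -- The criteria compare coordinate vectors; injectivity turns this into a comparison of the
  -- weights themselves.
  simp only [ne_eq, (weightCoord_injective b).eq_iff, and_self]
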